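/- Let $S^2\subset\mathbb R^3$ be the unit sphere with its surface area measure $dp$, of total mass $|S^2|=4\pi$, let $N\ge 1$, and let $dS$ be the product measure on $(S^2)^N$. Let $\mathcal P:(S^2)^N\to\mathbb R$ be a sampling pattern, i.e. an integrable function with $\mathcal P\ge 0$ and $\int_{(S^2)^N}\mathcal P(S)\,dS=|S^2|$, and suppose that $\mathcal P$ is homogeneous with respect to $SO(3)$: $\mathcal P(\gamma s_1,\dots,\gamma s_N)=\mathcal P(s_1,\dots,s_N)$ for all $\gamma\in SO(3)$ and all $(s_1,\dots,s_N)\in(S^2)^N$. For $F\in L^2(S^2,\mathbb C)$ and $S=(s_1,\dots,s_N)$ put $\mathrm{MC}(F,S)=\frac1N\sum_{i=1}^N F(s_i)$. For a weight $Q\ge0$ on $(S^2)^N$ put $$\mathbb E_Q[X]=\int_{(S^2)^N}X(S)\,Q(S)\,dS,\qquad \mathrm{Var}_Q[X]=\mathbb E_Q\big[|X|^2\big]-\big|\mathbb E_Q[X]\big|^2 .$$ Let $Y_l^m$ ($l\ge0$, $-l\le m\le l$) be the standard spherical harmonics, orthonormal for $dp$, and let $\widehat F_l^m=\int_{S^2}F\,\overline{Y_l^m}\,dp$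 and $\widehat S_l^m=\frac1N\sum_{i=1}^N\overline{Y_l^m(s_i)}$ be the spherical harmonic coefficients of $F$ and of the average $\frac1N\sum_i\delta_{s_i}$ of delta functions. Then all the expected values below are given by convergent integrals, the Monte Carlo estimate is unbiased, $$\mathbb E_{\mathcal P}\big[\mathrm{MC}(F,S)\big]=\int_{S^2}F(p)\,dp,$$ and, with $Q=\mathcal P/|S^2|$ the probability density of the sampling pattern, $$\mathrm{Var}_{Q}\big[\mathrm{MC}(F,S)\big]=\sum_{l=1}^\infty\frac{\Big(\sum_{m=-l}^{l}|\widehat F_l^m|^2\Big)\Big(\sum_{m=-l}^{l}\mathbb E_{Q}\big[|\widehat S_l^m|^2\big]\Big)}{2l+1},$$ where the series converges. -/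

import Mathlib

open MeasureTheory
open scoped ComplexConjugate

noncomputable section

/-- The unit sphere `S²` in Euclidean 3-space. -/
abbrev S2 : Type := Metric.sphere (0 : EuclideanSpace ℝ (Fin 3)) 1

/-- The surface area measure on `S²` (of total mass `4π`). -/
def surfaceMeasure : Measure S2 := (volume : Measure (EuclideanSpace ℝ (Fin 3))).toSphere

instance : IsFiniteMeasure surfaceMeasure := by
  unfold surfaceMeasure; infer_instance

/-- The measure `|S²|` of the domain. -/
def sphereArea : ℝ := surfaceMeasure.real Set.univ

/-- The product measure `dS` on the set `(S²)^N` of `N`-tuples of points. -/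
def tupleMeasure (N : ℕ) : Measure (Fin N → S2) := Measure.pi fun _ => surfaceMeasure

/-- The rotation group `SO(3)`. -/
abbrev SO3 : Type := Matrix.specialOrthogonalGroup (Fin 3) ℝ

theorem norm_toLp_mulVec (γ : SO3) (v : EuclideanSpace ℝ (Fin 3)) :
    ‖WithLp.toLp 2 (γ.1.mulVec v.ofLp)‖ = ‖v‖ := by
  have h : γ.1.transpose * γ.1 = 1 :=
    (Matrix.mem_orthogonalGroup_iff' (Fin 3) ℝ).1 (Matrix.mem_specialOrthogonalGroup_iff.1 γ.2).1
  have key : (γ.1.mulVec v.ofLp) ⬝ᵥ (γ.1.mulVec v.ofLp) = v.ofLp ⬝ᵥ v.ofLp := by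
    rw [Matrix.dotProduct_mulVec, ← Matrix.mulVec_transpose, Matrix.mulVec_mulVec, h,
      Matrix.one_mulVec]
  have e : ∀ w : EuclideanSpace ℝ (Fin 3), ‖w‖ ^ 2 = w.ofLp ⬝ᵥ w.ofLp := by
    intro w
    rw [EuclideanSpace.norm_sq_eq]
    simp [dotProduct, sq]
  have := e (WithLp.toLp 2 (γ.1.mulVec v.ofLp))
  exact (sq_eq_sq₀ (norm_nonneg _) (norm_nonneg _)).1 (by rw [this, e v]; exact key)

/-- The action of a rotation on a point of the sphere: the matrix-vector product. -/
def rotate (γ : SO3) (p : S2) : S2 :=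
  ⟨WithLp.toLp 2 (γ.1.mulVec p.1.ofLp), by
    rw [mem_sphere_zero_iff_norm, norm_toLp_mulVec]
    exact mem_sphere_zero_iff_norm.1 p.2⟩

/-- A sampling pattern: a nonnegative function on `(S²)^N` whose integral is `|S²|`. -/
structure IsSamplingPattern {N : ℕ} (P : (Fin N → S2) → ℝ) : Prop where
  nonneg : ∀ S, 0 ≤ P S
  integrable : Integrable P (tupleMeasure N)
  integral_eq : ∫ S, P S ∂tupleMeasure N = sphereArea

/-- Homogeneity with respect to `SO(3)`: rotating all the sample positions by a common rotation
does not change the value of the pattern. -/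
def IsHomogeneous {N : ℕ} (P : (Fin N → S2) → ℝ) : Prop :=
  ∀ (γ : SO3) (S : Fin N → S2), P (fun i => rotate γ (S i)) = P S

/-- The Monte Carlo estimate: the average of `F` over the sample positions. -/
def MC {N : ℕ} (F : S2 → ℂ) (S : Fin N → S2) : ℂ := (1 / (N : ℂ)) * ∑ i, F (S i)

/-- The expected value `∫ X(S) P(S) dS` of a (real or complex) quantity `X`, weighted by `P`. -/
def mean {E : Type*} [NormedAddCommGroup E] [NormedSpace ℝ E] {N : ℕ}
    (P : (Fin N → S2) → ℝ) (X : (Fin N → S2) → E) : E :=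
  ∫ S, P S • X S ∂tupleMeasure N

/-- The variance `E(|X|²) - |E(X)|²`, with expected values weighted by `P`. -/
def variance {N : ℕ} (P : (Fin N → S2) → ℝ) (X : (Fin N → S2) → ℂ) : ℝ :=
  mean P (fun S => ‖X S‖ ^ 2) - ‖mean P X‖ ^ 2

/-- The probability density `P / |S²|` of a sampling pattern. -/
def density {N : ℕ} (P : (Fin N → S2) → ℝ) (S : Fin N → S2) : ℝ := P S / sphereArea

/-- The spherical harmonic `Y_l^m` for `0 ≤ m ≤ l`, in Cartesian coordinates. With
`x + iy = sin θ e^{iφ}` and `z = cos θ` this is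
`√((2l+1)/(4π) · (l-m)!/(l+m)!) · P_l^m(cos θ) · e^{imφ}`, where, by Rodrigues' formula,
`P_l^m(t) = (-1)^m (1-t²)^{m/2} (1/(2^l l!)) (d/dt)^{l+m} (t²-1)^l`. -/
def sphericalHarmonicNat (l m : ℕ) (p : S2) : ℂ :=
  (Real.sqrt ((2 * l + 1) / (4 * Real.pi) * ((l - m).factorial / (l + m).factorial)) : ℂ) *
    (-1) ^ m * ((p.1 0 : ℂ) + Complex.I * (p.1 1 : ℂ)) ^ m *
    ((1 / (2 ^ l * l.factorial) *
      ((Polynomial.derivative^[l + m]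
        ((Polynomial.X ^ 2 - 1) ^ l : Polynomial ℝ)).eval (p.1 2)) : ℝ) : ℂ)

/-- The spherical harmonic `Y_l^m` of frequency `l` and index `-l ≤ m ≤ l`; for negative index,
`Y_l^{-m} = (-1)^m` times the complex conjugate of `Y_l^m`. -/
def sphericalHarmonic (l : ℕ) (m : ℤ) (p : S2) : ℂ :=
  if 0 ≤ m then sphericalHarmonicNat l m.natAbs p
  else (-1) ^ m.natAbs * conj (sphericalHarmonicNat l m.natAbs p)

/-- The spherical harmonic coefficient `⟨F, Y_l^m⟩` of a function `F`. -/
def coeff (F : S2 → ℂ) (l : ℕ) (m : ℤ) : ℂ :=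
  ∫ p, F p * conj (sphericalHarmonic l m p) ∂surfaceMeasure

/-- The spherical harmonic coefficient `⟨S, Y_l^m⟩` of the average
`S = (1/N) ∑ δ_{s_i}` of delta functions at the sample positions. -/
def sampleCoeff {N : ℕ} (S : Fin N → S2) (l : ℕ) (m : ℤ) : ℂ :=
  (1 / (N : ℂ)) * ∑ i, conj (sphericalHarmonic l m (S i))

end

/-! ### Rotations of the sphere -/

/-! Let `μ` be the measure `P dS`. It has mass `4π` and is invariant under simultaneous rotations,
so `covForm μ f g = ∫ MC f · conj (MC g) dμ` is an invariant sesquilinear form. By Schur's lemma it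
is diagonal on the spherical harmonics, with a diagonal value `c l` that depends on the frequency
alone (`covForm_eq_zero`, `covForm_self_eq`).

Schur's lemma is proved infinitesimally, without averaging over the group. Integrals of derivatives
along rotation flows vanish, so the raising and lowering operators built from two rotation axes are
adjoint for the form; their explicit action on `Y_l^m` (`hasLadder_sphericalHarmonic`) comes from
the Legendre equation. The same argument for `N = 1` gives orthogonality in `L²(S²)`, and one
explicit integral gives the normalization. Completeness is Stone–Weierstrass.

The ladder operators also show that every one-point marginal of `μ` kills the harmonics of positive
frequency. By completeness the marginal is the surface measure (`measurePreserving_eval`). Hence the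
estimate is unbiased, and `MC` is a bounded operator from `L²(S²)` to `L²(μ)`. Applied to the
expansion of `F`, it gives an orthogonal series, so the second moment is `∑ |coeff F l m|² c l`. Up
to the factor `1/(4π)`, `c l` is the average over `m` of the expected power of the samples, and the
term `l = 0` is the squared mean that the variance subtracts. -/

theorem rotate_one (p : S2) : rotate 1 p = p := by
  apply Subtype.ext
  simp [rotate]

theorem rotate_mul (γ δ : SO3) (p : S2) : rotate (γ * δ) p = rotate γ (rotate δ p) := by
  apply Subtype.ext
  simp [rotate, Matrix.mulVec_mulVec]

theorem continuous_rotate (γ : SO3) : Continuous (rotate γ) := by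
  refine Continuous.subtype_mk ((PiLp.continuous_toLp 2 _).comp ?_) _
  exact Continuous.matrix_mulVec continuous_const
    ((PiLp.continuous_ofLp 2 _).comp continuous_subtype_val)

/-- A rotation as a homeomorphism of the sphere. -/
def rotateHomeomorph (γ : SO3) : S2 ≃ₜ S2 where
  toFun := rotate γ
  invFun := rotate γ⁻¹
  left_inv p := by rw [← rotate_mul, inv_mul_cancel, rotate_one]
  right_inv p := by rw [← rotate_mul, mul_inv_cancel, rotate_one]
  continuous_toFun := continuous_rotate γ
  continuous_invFun := continuous_rotate γ⁻¹

/-- A rotation as a linear isometry of Euclidean space. -/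
noncomputable def rotationIsometry (γ : SO3) :
    EuclideanSpace ℝ (Fin 3) ≃ₗᵢ[ℝ] EuclideanSpace ℝ (Fin 3) :=
  LinearIsometry.toLinearIsometryEquiv
    { toFun := fun v => WithLp.toLp 2 (γ.1.mulVec v.ofLp)
      map_add' := fun v w => by simp [Matrix.mulVec_add]
      map_smul' := fun c v => by simp [Matrix.mulVec_smul]
      norm_map' := norm_toLp_mulVec γ } rfl

theorem rotationIsometry_coe (γ : SO3) (p : S2) : rotationIsometry γ p = (rotate γ p : S2) := rfl

-- The surface measure of a set is three times the volume of the cone over it in the unit ball. A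
-- rotation is a linear isometry, so it carries cones to cones and preserves volume.
open scoped Pointwise in
theorem measurePreserving_rotate (γ : SO3) :
    MeasurePreserving (rotate γ) surfaceMeasure surfaceMeasure := by
  refine ⟨(continuous_rotate γ).measurable, Measure.ext fun s hs => ?_⟩
  rw [Measure.map_apply (continuous_rotate γ).measurable hs, surfaceMeasure,
    Measure.toSphere_apply' _ hs,
    Measure.toSphere_apply' _ ((continuous_rotate γ).measurable hs)]
  congr 1
  have : Set.Ioo (0 : ℝ) 1 • ((fun p : S2 => (p : EuclideanSpace ℝ (Fin 3))) '' (rotate γ ⁻¹' s))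
      = rotationIsometry γ ⁻¹' (Set.Ioo (0 : ℝ) 1 •
        ((fun p : S2 => (p : EuclideanSpace ℝ (Fin 3))) '' s)) := by
    ext v
    simp only [Set.mem_smul, Set.mem_image, Set.mem_preimage]
    constructor
    · rintro ⟨r, hr, _, ⟨p, hp, rfl⟩, rfl⟩
      exact ⟨r, hr, _, ⟨rotate γ p, hp, rfl⟩, by rw [map_smul, rotationIsometry_coe]⟩
    · rintro ⟨r, hr, _, ⟨p, hp, rfl⟩, h⟩
      have hq : rotate γ ((rotateHomeomorph γ).symm p) = p := (rotateHomeomorph γ).apply_symm_apply p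
      refine ⟨r, hr, _, ⟨(rotateHomeomorph γ).symm p, ?_, rfl⟩, ?_⟩
      · simpa only [hq] using hp
      · apply (rotationIsometry γ).injective
        rw [map_smul, rotationIsometry_coe, hq, h]
  rw [this]
  exact ((rotationIsometry γ).measurePreserving).measure_preimage_emb
    (rotationIsometry γ).toHomeomorph.measurableEmbedding _

/-- The diagonal action of a rotation on tuples of points of the sphere. -/
def rotateTuple {N : ℕ} (γ : SO3) (S : Fin N → S2) : Fin N → S2 := fun i => rotate γ (S i)

theorem continuous_rotateTuple {N : ℕ} (γ : SO3) :
    Continuous (rotateTuple γ : (Fin N → S2) → _) :=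
  continuous_pi fun i => (continuous_rotate γ).comp (continuous_apply i)

theorem measurableEmbedding_rotateTuple {N : ℕ} (γ : SO3) :
    MeasurableEmbedding (rotateTuple γ : (Fin N → S2) → _) :=
  (Homeomorph.piCongrRight fun _ : Fin N => rotateHomeomorph γ).measurableEmbedding

/-! ### Rotation invariant measures on tuples. -/

instance (N : ℕ) : IsFiniteMeasure (tupleMeasure N) := by
  unfold tupleMeasure; infer_instance

theorem measurePreserving_rotateTuple {N : ℕ} (γ : SO3) :
    MeasurePreserving (rotateTuple γ) (tupleMeasure N) (tupleMeasure N) :=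
  measurePreserving_pi _ _ fun _ => measurePreserving_rotate γ

/-- A measure on tuples of points of the sphere that is invariant under simultaneous rotations. -/
def IsRotationInvariant {N : ℕ} (μ : Measure (Fin N → S2)) : Prop :=
  ∀ γ : SO3, MeasurePreserving (rotateTuple γ) μ μ

/-- The measure on tuples whose density is a sampling pattern. -/
noncomputable def patternMeasure {N : ℕ} (P : (Fin N → S2) → ℝ) : Measure (Fin N → S2) :=
  (tupleMeasure N).withDensity fun S => ENNReal.ofReal (P S)

theorem isRotationInvariant_patternMeasure {N : ℕ} {P : (Fin N → S2) → ℝ}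
    (hhom : IsHomogeneous P) : IsRotationInvariant (patternMeasure P) := by
  intro γ
  have hm := (continuous_rotateTuple (N := N) γ).measurable
  refine ⟨hm, Measure.ext fun s hs => ?_⟩
  rw [Measure.map_apply hm hs, patternMeasure, withDensity_apply _ hs, withDensity_apply _ (hm hs),
    ← (measurePreserving_rotateTuple γ).setLIntegral_comp_preimage_emb
      (measurableEmbedding_rotateTuple γ) _ s]
  refine lintegral_congr fun S => ?_
  exact congrArg _ (hhom γ S).symm

theorem integral_patternMeasure {N : ℕ} {P : (Fin N → S2) → ℝ} (hP : IsSamplingPattern P)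
    {E : Type*} [NormedAddCommGroup E] [NormedSpace ℝ E] (X : (Fin N → S2) → E) :
    ∫ S, X S ∂patternMeasure P = mean P X := by
  rw [patternMeasure, integral_withDensity_eq_integral_toReal_smul₀
    hP.integrable.aestronglyMeasurable.aemeasurable.ennreal_ofReal
    (Filter.Eventually.of_forall fun _ => ENNReal.ofReal_lt_top), mean]
  simp only [ENNReal.toReal_ofReal (hP.nonneg _)]

theorem integrable_patternMeasure_iff {N : ℕ} {P : (Fin N → S2) → ℝ} (hP : IsSamplingPattern P)
    {E : Type*} [NormedAddCommGroup E] [NormedSpace ℝ E] (X : (Fin N → S2) → E) :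
    Integrable X (patternMeasure P) ↔ Integrable (fun S => P S • X S) (tupleMeasure N) := by
  rw [patternMeasure, integrable_withDensity_iff_integrable_smul₀'
    hP.integrable.aestronglyMeasurable.aemeasurable.ennreal_ofReal
    (Filter.Eventually.of_forall fun _ => ENNReal.ofReal_lt_top)]
  simp only [ENNReal.toReal_ofReal (hP.nonneg _)]

theorem isFiniteMeasure_patternMeasure {N : ℕ} {P : (Fin N → S2) → ℝ}
    (hP : IsSamplingPattern P) : IsFiniteMeasure (patternMeasure P) :=
  isFiniteMeasure_withDensity_ofReal hP.integrable.2

theorem sphereArea_eq : sphereArea = 4 * Real.pi := by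
  rw [sphereArea, surfaceMeasure, Measure.toSphere_real_apply_univ, measureReal_def,
    EuclideanSpace.volume_ball_fin_three]
  simp
  rw [ENNReal.toReal_ofReal (by positivity)]
  ring

theorem integral_const_surfaceMeasure (c : ℂ) :
    ∫ _, c ∂surfaceMeasure = 4 * Real.pi * c := by
  rw [integral_const, ← sphereArea, sphereArea_eq]
  simp

/-- The rotation by the angle `t` about the first axis. -/
noncomputable def rotX (t : ℝ) : SO3 :=
  ⟨!![1, 0, 0; 0, Real.cos t, -Real.sin t; 0, Real.sin t, Real.cos t], by
    rw [Matrix.mem_specialOrthogonalGroup_iff, Matrix.mem_orthogonalGroup_iff]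
    have := Real.sin_sq_add_cos_sq t
    constructor
    · ext i j
      fin_cases i <;> fin_cases j <;> simp [Matrix.mul_apply, Fin.sum_univ_three]
        <;> nlinarith
    · simp [Matrix.det_fin_three]
      nlinarith⟩

/-- The rotation by the angle `t` about the second axis. -/
noncomputable def rotY (t : ℝ) : SO3 :=
  ⟨!![Real.cos t, 0, Real.sin t; 0, 1, 0; -Real.sin t, 0, Real.cos t], by
    rw [Matrix.mem_specialOrthogonalGroup_iff, Matrix.mem_orthogonalGroup_iff]
    have := Real.sin_sq_add_cos_sq t
    constructor
    · ext i j
      fin_cases i <;> fin_cases j <;> simp [Matrix.mul_apply, Fin.sum_univ_three]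
        <;> nlinarith
    · simp [Matrix.det_fin_three]
      nlinarith⟩

theorem rotX_zero : rotX 0 = 1 := by
  apply Subtype.ext
  ext i j
  fin_cases i <;> fin_cases j <;> simp [rotX]

theorem rotY_zero : rotY 0 = 1 := by
  apply Subtype.ext
  ext i j
  fin_cases i <;> fin_cases j <;> simp [rotY]

theorem rotX_add (s t : ℝ) : rotX (s + t) = rotX s * rotX t := by
  apply Subtype.ext
  ext i j
  fin_cases i <;> fin_cases j <;>
    simp [rotX, Real.sin_add, Real.cos_add] <;> ring

theorem rotY_add (s t : ℝ) : rotY (s + t) = rotY s * rotY t := by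
  apply Subtype.ext
  ext i j
  fin_cases i <;> fin_cases j <;>
    simp [rotY, Real.sin_add, Real.cos_add] <;> ring

/-! ### Derivatives along rotations -/

/-- `f'` is the derivative of `f` at time zero along the curves `t ↦ act t x`, and both functions
are continuous. -/
structure HasFlowDeriv {X : Type*} [TopologicalSpace X] (act : ℝ → X → X) (f f' : X → ℂ) :
    Prop where
  cont : Continuous f
  cont' : Continuous f'
  deriv : ∀ x, HasDerivAt (fun t => f (act t x)) (f' x) 0

/-- The integral of a derivative along a measure preserving flow vanishes. -/
theorem HasFlowDeriv.integral_eq_zero {X : Type*} [TopologicalSpace X] [CompactSpace X]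
    [MeasurableSpace X] [BorelSpace X] {μ : Measure X} [IsFiniteMeasure μ]
    {act : ℝ → X → X} (hadd : ∀ s t x, act (s + t) x = act s (act t x))
    (hzero : ∀ x, act 0 x = x)
    (hcont : ∀ t, Continuous (act t)) (hact : ∀ t, MeasurePreserving (act t) μ μ)
    {f f' : X → ℂ} (h : HasFlowDeriv act f f') : ∫ x, f' x ∂μ = 0 := by
  obtain ⟨C, hC⟩ := isCompact_univ.exists_bound_of_continuousOn h.cont'.continuousOn
  have hasm : ∀ {g : X → ℂ}, Continuous g → AEStronglyMeasurable g μ := fun hg =>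
    (hg.stronglyMeasurable_of_hasCompactSupport
      (HasCompactSupport.of_compactSpace _)).aestronglyMeasurable
  have hint : ∀ {g : X → ℂ}, Continuous g → Integrable g μ := fun hg => by
    obtain ⟨C, hC⟩ := isCompact_univ.exists_bound_of_continuousOn hg.continuousOn
    exact Integrable.of_bound (hasm hg) C (Filter.Eventually.of_forall fun x => hC x trivial)
  -- Differentiability is given at time zero only; the group law moves it to time `t` by restarting
  -- the flow at `act t x`.
  have hd : ∀ (x : X) (t : ℝ), HasDerivAt (fun t => f (act t x)) (f' (act t x)) t := by
    intro x t
    have h1 := h.deriv (act t x)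
    rw [show (0 : ℝ) = t - t by ring] at h1
    simpa only [← hadd, sub_add_cancel] using h1.comp_sub_const t t
  have key := (hasDerivAt_integral_of_dominated_loc_of_deriv_le (μ := μ)
    (F := fun t x => f (act t x)) (F' := fun t x => f' (act t x)) (x₀ := (0 : ℝ))
    (bound := fun _ => C) Filter.univ_mem
    (Filter.Eventually.of_forall fun t => hasm (h.cont.comp (hcont t)))
    (hint (h.cont.comp (hcont 0))) (hasm (h.cont'.comp (hcont 0)))
    (Filter.Eventually.of_forall fun x t _ => hC _ trivial) (integrable_const C)
    (Filter.Eventually.of_forall fun x t _ => hd x t)).2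
  -- The flow preserves `μ`, so the integral just differentiated under the integral sign is constant
  -- in `t`.
  have hconst : (fun t => ∫ x, f (act t x) ∂μ) = fun _ => ∫ x, f x ∂μ := by
    funext t
    have := integral_map (μ := μ) (hact t).measurable.aemeasurable (f := f)
      (hasm h.cont |>.mono_ac (hact t).map_eq.absolutelyContinuous)
    rw [← this, (hact t).map_eq]
  rw [hconst] at key
  simpa only [hzero] using key.unique (hasDerivAt_const _ _)

namespace HasFlowDeriv

variable {X : Type*} [TopologicalSpace X] {act : ℝ → X → X}

theorem mul (hzero : ∀ x, act 0 x = x) {f f' g g' : X → ℂ} (hf : HasFlowDeriv act f f')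
    (hg : HasFlowDeriv act g g') :
    HasFlowDeriv act (fun x => f x * g x) (fun x => f' x * g x + f x * g' x) where
  cont := hf.cont.mul hg.cont
  cont' := (hf.cont'.mul hg.cont).add (hf.cont.mul hg.cont')
  deriv x := by
    have := (hf.deriv x).mul (hg.deriv x)
    simp only [hzero] at this
    exact this

theorem star {f f' : X → ℂ} (hf : HasFlowDeriv act f f') :
    HasFlowDeriv act (fun x => conj (f x)) (fun x => conj (f' x)) where
  cont := Complex.continuous_conj.comp hf.cont
  cont' := Complex.continuous_conj.comp hf.cont'
  deriv x := (hf.deriv x).star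

theorem const (c : ℂ) : HasFlowDeriv act (fun _ => c) (fun _ => 0) where
  cont := continuous_const
  cont' := continuous_const
  deriv _ := hasDerivAt_const _ _

theorem polynomial_comp (hzero : ∀ x, act 0 x = x) {f f' : X → ℂ} (hf : HasFlowDeriv act f f')
    (q : Polynomial ℂ) :
    HasFlowDeriv act (fun x => q.eval (f x)) (fun x => q.derivative.eval (f x) * f' x) where
  cont := q.continuous.comp hf.cont
  cont' := (q.derivative.continuous.comp hf.cont).mul hf.cont'
  deriv x := by
    have h := hf.deriv x
    have := (q.hasDerivAt (f (act 0 x))).comp (0 : ℝ) h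
    simp only [hzero] at this
    exact this

theorem apply_tuple {N : ℕ} {R : ℝ → SO3} {f f' : S2 → ℂ}
    (hf : HasFlowDeriv (fun t => rotate (R t)) f f') (i : Fin N) :
    HasFlowDeriv (fun t => rotateTuple (N := N) (R t)) (fun S => f (S i)) (fun S => f' (S i)) where
  cont := hf.cont.comp (continuous_apply i)
  cont' := hf.cont'.comp (continuous_apply i)
  deriv S := hf.deriv (S i)

/-- All points of the tuple are rotated together, so `MC` commutes with the flows and hence with
their derivatives. -/
theorem monteCarlo {N : ℕ} {R : ℝ → SO3} {f f' : S2 → ℂ}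
    (hf : HasFlowDeriv (fun t => rotate (R t)) f f') :
    HasFlowDeriv (fun t => rotateTuple (N := N) (R t)) (MC f) (MC f') where
  cont := continuous_const.mul
    (continuous_finsetSum _ fun i _ => hf.cont.comp (continuous_apply i))
  cont' := continuous_const.mul
    (continuous_finsetSum _ fun i _ => hf.cont'.comp (continuous_apply i))
  deriv S := by
    have := HasDerivAt.fun_sum (u := Finset.univ) fun (i : Fin N) _ => hf.deriv (S i)
    exact this.const_mul (1 / (N : ℂ))

end HasFlowDeriv

/-- `fp` and `fm` are the images of `f` under the raising operator `∂₂ - i ∂₁` and the lowering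
operator `-∂₂ - i ∂₁`, where `∂₁` and `∂₂` are the derivatives along the rotations about the first
and the second axis. -/
structure HasLadder (f fp fm : S2 → ℂ) : Prop where
  cont_fp : Continuous fp
  cont_fm : Continuous fm
  derivX : HasFlowDeriv (fun t => rotate (rotX t)) f fun p => Complex.I / 2 * (fp p + fm p)
  derivY : HasFlowDeriv (fun t => rotate (rotY t)) f fun p => (fp p - fm p) / 2

theorem rotate_rotX_zero (p : S2) : rotate (rotX 0) p = p := by rw [rotX_zero, rotate_one]

theorem rotate_rotY_zero (p : S2) : rotate (rotY 0) p = p := by rw [rotY_zero, rotate_one]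

theorem rotateTuple_rotX_zero {N : ℕ} (S : Fin N → S2) : rotateTuple (rotX 0) S = S :=
  funext fun i => rotate_rotX_zero (S i)

theorem rotateTuple_rotY_zero {N : ℕ} (S : Fin N → S2) : rotateTuple (rotY 0) S = S :=
  funext fun i => rotate_rotY_zero (S i)

/-! ### Integration by parts against an invariant measure. -/

section Invariant

variable {N : ℕ} {μ : Measure (Fin N → S2)} [IsFiniteMeasure μ]

theorem IsRotationInvariant.integral_derivX (hμ : IsRotationInvariant μ)
    {h h' : (Fin N → S2) → ℂ} (hh : HasFlowDeriv (fun t => rotateTuple (rotX t)) h h') :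
    ∫ S, h' S ∂μ = 0 :=
  hh.integral_eq_zero (fun s t S => funext fun i => by simp [rotateTuple, rotX_add, rotate_mul])
    rotateTuple_rotX_zero (fun _ => continuous_rotateTuple _) (fun _ => hμ _)

theorem IsRotationInvariant.integral_derivY (hμ : IsRotationInvariant μ)
    {h h' : (Fin N → S2) → ℂ} (hh : HasFlowDeriv (fun t => rotateTuple (rotY t)) h h') :
    ∫ S, h' S ∂μ = 0 :=
  hh.integral_eq_zero (fun s t S => funext fun i => by simp [rotateTuple, rotY_add, rotate_mul])
    rotateTuple_rotY_zero (fun _ => continuous_rotateTuple _) (fun _ => hμ _)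

theorem integrable_of_continuous {X : Type*} [TopologicalSpace X] [CompactSpace X]
    [MeasurableSpace X] [BorelSpace X] {μ : Measure X} [IsFiniteMeasure μ] {h : X → ℂ}
    (hh : Continuous h) : Integrable h μ :=
  hh.integrable_of_hasCompactSupport (HasCompactSupport.of_compactSpace _)

/-- The sesquilinear form `∫ MC(f, S) conj (MC(g, S)) dμ(S)`. -/
noncomputable def covForm (μ : Measure (Fin N → S2)) (f g : S2 → ℂ) : ℂ :=
  ∫ S, MC f S * conj (MC g S) ∂μ

theorem continuous_MC {f : S2 → ℂ} (hf : Continuous f) :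
    Continuous (MC f : (Fin N → S2) → ℂ) :=
  continuous_const.mul (continuous_finsetSum _ fun i _ => hf.comp (continuous_apply i))

theorem continuous_MC_mul_conj {f g : S2 → ℂ} (hf : Continuous f) (hg : Continuous g) :
    Continuous fun S : Fin N → S2 => MC f S * conj (MC g S) :=
  (continuous_MC hf).mul (Complex.continuous_conj.comp (continuous_MC hg))

theorem MC_const_mul (c : ℂ) (f : S2 → ℂ) (S : Fin N → S2) :
    MC (fun p => c * f p) S = c * MC f S := by
  simp only [MC, ← Finset.mul_sum]
  ring

theorem MC_linear (c d : ℂ) (f g : S2 → ℂ) (S : Fin N → S2) :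
    MC (fun p => c * f p + d * g p) S = c * MC f S + d * MC g S := by
  simp only [MC, Finset.sum_add_distrib, ← Finset.mul_sum]
  ring

omit [IsFiniteMeasure μ] in
theorem covForm_const_mul_left (c : ℂ) (f g : S2 → ℂ) :
    covForm μ (fun p => c * f p) g = c * covForm μ f g := by
  simp only [covForm, MC_const_mul, mul_assoc, integral_const_mul]

omit [IsFiniteMeasure μ] in
theorem covForm_const_mul_right (c : ℂ) (f g : S2 → ℂ) :
    covForm μ f (fun p => c * g p) = conj c * covForm μ f g := by
  simp only [covForm, MC_const_mul, map_mul]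
  rw [← integral_const_mul]
  congr 1
  funext S
  ring

theorem integral_four_linear {X : Type*} [MeasurableSpace X] {μ : Measure X} {a b d e : X → ℂ}
    (ha : Integrable a μ) (hb : Integrable b μ) (hd : Integrable d μ) (he : Integrable e μ)
    {r s t u : ℂ} : ∫ x, r * a x + s * b x + (t * d x + u * e x) ∂μ =
      r * ∫ x, a x ∂μ + s * ∫ x, b x ∂μ + (t * ∫ x, d x ∂μ + u * ∫ x, e x ∂μ) := by
  rw [integral_add (f := fun x => r * a x + s * b x) (g := fun x => t * d x + u * e x)
      ((ha.const_mul _).add (hb.const_mul _)) ((hd.const_mul _).add (he.const_mul _)),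
    integral_add (ha.const_mul _) (hb.const_mul _), integral_add (hd.const_mul _) (he.const_mul _)]
  simp only [integral_const_mul]

/-- By the product rule and invariance, `∂₁` and `∂₂` are skew-adjoint for the form. Hence the
adjoint of `∂₂ - i ∂₁` is `-∂₂ - i ∂₁`. -/
theorem IsRotationInvariant.covForm_adjoint (hμ : IsRotationInvariant μ)
    {f fp fm g gp gm : S2 → ℂ} (hf : HasLadder f fp fm) (hg : HasLadder g gp gm) :
    covForm μ fp g = covForm μ f gm ∧ covForm μ fm g = covForm μ f gp := by
  have hX := hμ.integral_derivX (hf.derivX.monteCarlo.mul rotateTuple_rotX_zero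
    hg.derivX.monteCarlo.star)
  have hY := hμ.integral_derivY (hf.derivY.monteCarlo.mul rotateTuple_rotY_zero
    hg.derivY.monteCarlo.star)
  have iX := fun {a b : S2 → ℂ} (ha : Continuous a) (hb : Continuous b) =>
    integrable_of_continuous (μ := μ) (continuous_MC_mul_conj ha hb)
  have e1 : ∀ S : Fin N → S2, MC (fun p => Complex.I / 2 * (fp p + fm p)) S * conj (MC g S) +
      MC f S * conj (MC (fun p => Complex.I / 2 * (gp p + gm p)) S) =
      Complex.I / 2 * (MC fp S * conj (MC g S)) + Complex.I / 2 * (MC fm S * conj (MC g S)) +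
      (-Complex.I / 2 * (MC f S * conj (MC gp S)) + -Complex.I / 2 * (MC f S * conj (MC gm S))) := by
    intro S
    simp only [mul_add, MC_linear, map_add, map_mul, map_div₀, Complex.conj_I, map_ofNat]
    ring
  have e2 : ∀ S : Fin N → S2, MC (fun p => (fp p - fm p) / 2) S * conj (MC g S) +
      MC f S * conj (MC (fun p => (gp p - gm p) / 2) S) =
      1 / 2 * (MC fp S * conj (MC g S)) + (-1 / 2) * (MC fm S * conj (MC g S)) +
      (1 / 2 * (MC f S * conj (MC gp S)) + (-1 / 2) * (MC f S * conj (MC gm S))) := by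
    intro S
    have h1 : ∀ a b : S2 → ℂ, (fun p => (a p - b p) / 2) = fun p => 1 / 2 * a p + (-1 / 2) * b p :=
      fun a b => funext fun p => by ring
    simp only [h1, MC_linear, map_add, map_mul, map_div₀, map_ofNat, map_one, map_neg]
    ring
  have hfg := hf.derivX.cont
  have hgc := hg.derivX.cont
  have j1 := iX hf.cont_fp hgc
  have j2 := iX hf.cont_fm hgc
  have j3 := iX hfg hg.cont_fp
  have j4 := iX hfg hg.cont_fm
  simp only [e1] at hX
  simp only [e2] at hY
  rw [integral_four_linear j1 j2 j3 j4] at hX hY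
  simp only [covForm]
  constructor
  · linear_combination (-Complex.I) * hX + hY + (1 / 2) * (
      (∫ S, MC fp S * conj (MC g S) ∂μ) + (∫ S, MC fm S * conj (MC g S) ∂μ) -
      (∫ S, MC f S * conj (MC gp S) ∂μ) - (∫ S, MC f S * conj (MC gm S) ∂μ)) * Complex.I_sq
  · linear_combination (-Complex.I) * hX - hY + (1 / 2) * (
      (∫ S, MC fp S * conj (MC g S) ∂μ) + (∫ S, MC fm S * conj (MC g S) ∂μ) -
      (∫ S, MC f S * conj (MC gp S) ∂μ) - (∫ S, MC f S * conj (MC gm S) ∂μ)) * Complex.I_sq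

/-- The integral of a function of one sample position that is in the range of the raising or
lowering operator vanishes. -/
theorem IsRotationInvariant.integral_ladder (hμ : IsRotationInvariant μ)
    {f fp fm : S2 → ℂ} (hf : HasLadder f fp fm) (i : Fin N) :
    ∫ S, fp (S i) ∂μ = 0 ∧ ∫ S, fm (S i) ∂μ = 0 := by
  have hX := hμ.integral_derivX (hf.derivX.apply_tuple i)
  have hY := hμ.integral_derivY (hf.derivY.apply_tuple i)
  have j1 := integrable_of_continuous (μ := μ) (hf.cont_fp.comp (continuous_apply i))
  have j2 := integrable_of_continuous (μ := μ) (hf.cont_fm.comp (continuous_apply i))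
  simp only [Function.comp_def] at j1 j2
  rw [integral_const_mul, integral_add j1 j2] at hX
  rw [integral_div, integral_sub j1 j2] at hY
  have hX' := (mul_eq_zero.1 hX).resolve_left (by simp)
  constructor
  · linear_combination (1 / 2) * hX' + hY
  · linear_combination (1 / 2) * hX' - hY

end Invariant

/-! ### Ladder operators on spherical harmonics -/

namespace HasLadder

variable {f fp fm g gp gm : S2 → ℂ}

theorem cont (hf : HasLadder f fp fm) : Continuous f := hf.derivX.cont

theorem congr {f' fp' fm' : S2 → ℂ} (hf : HasLadder f fp fm) (h : ∀ p, f' p = f p)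
    (hp : ∀ p, fp' p = fp p) (hm : ∀ p, fm' p = fm p) : HasLadder f' fp' fm' := by
  rw [funext h, funext hp, funext hm]
  exact hf

theorem of_flow (hp : Continuous fp) (hm : Continuous fm) {fX fY : S2 → ℂ}
    (hX : HasFlowDeriv (fun t => rotate (rotX t)) f fX)
    (hY : HasFlowDeriv (fun t => rotate (rotY t)) f fY)
    (eX : ∀ p, fX p = Complex.I / 2 * (fp p + fm p)) (eY : ∀ p, fY p = (fp p - fm p) / 2) :
    HasLadder f fp fm :=
  ⟨hp, hm, funext eX ▸ hX, funext eY ▸ hY⟩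

theorem mul (hf : HasLadder f fp fm) (hg : HasLadder g gp gm) :
    HasLadder (fun p => f p * g p) (fun p => fp p * g p + f p * gp p)
      (fun p => fm p * g p + f p * gm p) :=
  of_flow ((hf.cont_fp.mul hg.cont).add (hf.cont.mul hg.cont_fp))
    ((hf.cont_fm.mul hg.cont).add (hf.cont.mul hg.cont_fm))
    (hf.derivX.mul rotate_rotX_zero hg.derivX) (hf.derivY.mul rotate_rotY_zero hg.derivY)
    (fun p => by ring) (fun p => by ring)

/-- Conjugation commutes with `∂₁` and `∂₂` but turns `i` into `-i`, so it exchanges raising and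
lowering up to a sign. -/
theorem star (hf : HasLadder f fp fm) :
    HasLadder (fun p => conj (f p)) (fun p => -conj (fm p)) (fun p => -conj (fp p)) :=
  of_flow (Complex.continuous_conj.comp hf.cont_fm).neg (Complex.continuous_conj.comp hf.cont_fp).neg
    hf.derivX.star hf.derivY.star
    (fun p => by simp only [map_mul, map_add, map_div₀, Complex.conj_I, map_ofNat]; ring)
    (fun p => by simp only [map_sub, map_div₀, map_ofNat]; ring)

theorem const (c : ℂ) : HasLadder (fun _ => c) (fun _ => 0) (fun _ => 0) :=
  of_flow continuous_const continuous_const (HasFlowDeriv.const c) (HasFlowDeriv.const c)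
    (fun p => by ring) (fun p => by ring)

theorem const_mul (c : ℂ) (hf : HasLadder f fp fm) :
    HasLadder (fun p => c * f p) (fun p => c * fp p) (fun p => c * fm p) :=
  ((const c).mul hf).congr (fun _ => rfl) (fun p => by ring) (fun p => by ring)

theorem polynomial_comp (hf : HasLadder f fp fm) (q : Polynomial ℂ) :
    HasLadder (fun p => q.eval (f p)) (fun p => q.derivative.eval (f p) * fp p)
      (fun p => q.derivative.eval (f p) * fm p) :=
  of_flow ((q.derivative.continuous.comp hf.cont).mul hf.cont_fp)
    ((q.derivative.continuous.comp hf.cont).mul hf.cont_fm)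
    (hf.derivX.polynomial_comp rotate_rotX_zero q) (hf.derivY.polynomial_comp rotate_rotY_zero q)
    (fun p => by ring) (fun p => by ring)

end HasLadder

/-! ### Ladder operators on coordinates and zonal polynomials. -/

/-- The complex coordinate `x + iy` of a point of the sphere. -/
noncomputable def coordU (p : S2) : ℂ := (p.1 0 : ℂ) + Complex.I * (p.1 1 : ℂ)

/-- A polynomial in the third coordinate of a point of the sphere. -/
noncomputable def zonal (q : Polynomial ℝ) (p : S2) : ℂ := ((q.eval (p.1 2) : ℝ) : ℂ)

theorem continuous_coord (i : Fin 3) : Continuous fun p : S2 => (p.1 i : ℂ) :=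
  Complex.continuous_ofReal.comp ((PiLp.continuous_apply 2 _ i).comp continuous_subtype_val)

theorem continuous_coordU : Continuous coordU :=
  (continuous_coord 0).add (continuous_const.mul (continuous_coord 1))

theorem continuous_conj_coordU : Continuous fun p => conj (coordU p) :=
  Complex.continuous_conj.comp continuous_coordU

theorem conj_zonal (q : Polynomial ℝ) (p : S2) : conj (zonal q p) = zonal q p :=
  Complex.conj_ofReal _

theorem conj_coordU (p : S2) : conj (coordU p) = (p.1 0 : ℂ) - Complex.I * (p.1 1 : ℂ) := by
  simp [coordU, sub_eq_add_neg]

theorem coordU_mul_conj (p : S2) : coordU p * conj (coordU p) = 1 - (p.1 2 : ℂ) ^ 2 := by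
  have h : ‖p.1‖ = 1 := mem_sphere_zero_iff_norm.1 p.2
  have h2 := EuclideanSpace.norm_sq_eq p.1
  rw [h, Fin.sum_univ_three] at h2
  simp only [Real.norm_eq_abs, sq_abs] at h2
  have h3 : (1 : ℂ) ^ 2 = (p.1 0 : ℂ) ^ 2 + (p.1 1 : ℂ) ^ 2 + (p.1 2 : ℂ) ^ 2 := by exact_mod_cast h2
  rw [conj_coordU, coordU]
  linear_combination (-(p.1 1 : ℂ) ^ 2) * Complex.I_sq - h3

theorem hasFlowDeriv_of_real {R : ℝ → SO3} {a b c : ℝ → ℂ} {i : Fin 3} {g : S2 → ℂ}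
    (hR : ∀ t (p : S2), ((rotate (R t) p).1 i : ℂ) = a t * p.1 0 + b t * p.1 1 + c t * p.1 2)
    {a' b' c' : ℂ} (ha : HasDerivAt a a' 0) (hb : HasDerivAt b b' 0) (hc : HasDerivAt c c' 0)
    (hg : ∀ p : S2, g p = a' * p.1 0 + b' * p.1 1 + c' * p.1 2) :
    HasFlowDeriv (fun t => rotate (R t)) (fun p => (p.1 i : ℂ)) g where
  cont := continuous_coord i
  cont' := by
    rw [funext hg]
    exact ((continuous_const.mul (continuous_coord 0)).add
      (continuous_const.mul (continuous_coord 1))).add (continuous_const.mul (continuous_coord 2))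
  deriv p := by
    simp only [hR, hg]
    exact ((ha.mul_const _).add (hb.mul_const _)).add (hc.mul_const _)

theorem hasDerivAt_cos_zero : HasDerivAt (fun t : ℝ => (Real.cos t : ℂ)) 0 0 := by
  simpa using (Real.hasDerivAt_cos 0).ofReal_comp

theorem hasDerivAt_sin_zero : HasDerivAt (fun t : ℝ => (Real.sin t : ℂ)) 1 0 := by
  simpa using (Real.hasDerivAt_sin 0).ofReal_comp

theorem hasLadder_coord_zero : HasLadder (fun p => (p.1 0 : ℂ)) (fun p => (p.1 2 : ℂ))
    (fun p => -(p.1 2 : ℂ)) := by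
  refine HasLadder.of_flow (continuous_coord 2) (continuous_coord 2).neg
    (hasFlowDeriv_of_real (a := fun _ => 1) (b := fun _ => 0) (c := fun _ => 0) (fun t p => ?_)
      (hasDerivAt_const _ _) (hasDerivAt_const _ _) (hasDerivAt_const _ _) (fun _ => rfl))
    (hasFlowDeriv_of_real (a := fun t => Real.cos t) (b := fun _ => 0) (c := fun t => Real.sin t)
      (fun t p => ?_)
      hasDerivAt_cos_zero (hasDerivAt_const _ _) hasDerivAt_sin_zero (fun _ => rfl))
    (fun p => by ring) (fun p => by ring)
  · simp [rotate, rotX, dotProduct, Fin.sum_univ_three]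
  · simp [rotate, rotY, dotProduct, Fin.sum_univ_three]

theorem hasLadder_coord_one : HasLadder (fun p => (p.1 1 : ℂ)) (fun p => Complex.I * (p.1 2 : ℂ))
    (fun p => Complex.I * (p.1 2 : ℂ)) := by
  refine HasLadder.of_flow (continuous_const.mul (continuous_coord 2))
    (continuous_const.mul (continuous_coord 2))
    (hasFlowDeriv_of_real (a := fun _ => 0) (b := fun t => Real.cos t) (c := fun t => -Real.sin t)
      (fun t p => ?_)
      (hasDerivAt_const _ _) hasDerivAt_cos_zero hasDerivAt_sin_zero.neg (fun _ => rfl))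
    (hasFlowDeriv_of_real (a := fun _ => 0) (b := fun _ => 1) (c := fun _ => 0) (fun t p => ?_)
      (hasDerivAt_const _ _) (hasDerivAt_const _ _) (hasDerivAt_const _ _) (fun _ => rfl))
    (fun p => by linear_combination (-(p.1 2 : ℂ)) * Complex.I_sq) (fun p => by ring)
  · simp [rotate, rotX, dotProduct, Fin.sum_univ_three]
  · simp [rotate, rotY, dotProduct, Fin.sum_univ_three]

theorem hasLadder_coord_two : HasLadder (fun p => (p.1 2 : ℂ)) (fun p => -coordU p)
    (fun p => conj (coordU p)) := by
  refine HasLadder.of_flow continuous_coordU.neg continuous_conj_coordU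
    (hasFlowDeriv_of_real (a := fun _ => 0) (b := fun t => Real.sin t) (c := fun t => Real.cos t)
      (fun t p => ?_)
      (hasDerivAt_const _ _) hasDerivAt_sin_zero hasDerivAt_cos_zero (fun _ => rfl))
    (hasFlowDeriv_of_real (a := fun t => -Real.sin t) (b := fun _ => 0) (c := fun t => Real.cos t)
      (fun t p => ?_)
      hasDerivAt_sin_zero.neg (hasDerivAt_const _ _) hasDerivAt_cos_zero (fun _ => rfl))
    (fun p => ?_) (fun p => ?_)
  · simp [rotate, rotX, dotProduct, Fin.sum_univ_three]
  · simp [rotate, rotY, dotProduct, Fin.sum_univ_three]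
  · rw [conj_coordU, coordU]
    linear_combination (p.1 1 : ℂ) * Complex.I_sq
  · rw [conj_coordU, coordU]
    ring

theorem hasLadder_coordU : HasLadder coordU (fun _ => 0) (fun p => -2 * (p.1 2 : ℂ)) := by
  have h := hasLadder_coord_one.const_mul Complex.I
  refine HasLadder.of_flow continuous_const (continuous_const.mul (continuous_coord 2))
    (fX := fun p => -Complex.I * (p.1 2 : ℂ)) (fY := fun p => (p.1 2 : ℂ)) ?_ ?_
    (fun p => by ring) (fun p => by ring)
  · refine ⟨continuous_coordU, continuous_const.mul (continuous_coord 2), fun p => ?_⟩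
    refine ((hasLadder_coord_zero.derivX.deriv p).add (h.derivX.deriv p)).congr_deriv ?_
    linear_combination (Complex.I * (p.1 2 : ℂ)) * Complex.I_sq
  · refine ⟨continuous_coordU, continuous_coord 2, fun p => ?_⟩
    refine ((hasLadder_coord_zero.derivY.deriv p).add (h.derivY.deriv p)).congr_deriv ?_
    ring

theorem zonal_eq_eval_map (q : Polynomial ℝ) (p : S2) :
    zonal q p = (q.map Complex.ofRealHom).eval ((p.1 2 : ℂ)) := by
  rw [zonal, Polynomial.eval_map, ← Complex.ofRealHom_eq_coe, ← Complex.ofRealHom_eq_coe,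
    Polynomial.eval₂_at_apply]

theorem hasLadder_zonal (q : Polynomial ℝ) :
    HasLadder (zonal q) (fun p => -(coordU p * zonal q.derivative p))
      (fun p => conj (coordU p) * zonal q.derivative p) := by
  refine (hasLadder_coord_two.polynomial_comp (q.map Complex.ofRealHom)).congr
    (zonal_eq_eval_map q) (fun p => ?_) (fun p => ?_) <;>
  · rw [Polynomial.derivative_map, ← zonal_eq_eval_map]
    ring

/-- Powers of `x + iy` are highest weight vectors. At `m = 0` the truncated exponent `m - 1` is
harmless because of the factor `m`. -/
theorem hasLadder_coordU_pow (m : ℕ) : HasLadder (fun p => coordU p ^ m) (fun _ => 0)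
    (fun p => -2 * m * coordU p ^ (m - 1) * (p.1 2 : ℂ)) := by
  refine (hasLadder_coordU.polynomial_comp (Polynomial.X ^ m)).congr
    (fun p => by simp) (fun p => by simp) (fun p => ?_)
  simp only [Polynomial.derivative_X_pow, Polynomial.eval_mul, Polynomial.eval_natCast,
    Polynomial.eval_pow, Polynomial.eval_X, map_natCast]
  ring

theorem zonal_mul (q r : Polynomial ℝ) (p : S2) : zonal (q * r) p = zonal q p * zonal r p := by
  simp [zonal]

theorem zonal_X (p : S2) : zonal Polynomial.X p = (p.1 2 : ℂ) := by simp [zonal]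

theorem hasLadder_coordU_pow_mul_zonal (m : ℕ) (q : Polynomial ℝ) :
    HasLadder (fun p => coordU p ^ m * zonal q p)
      (fun p => -(coordU p ^ (m + 1) * zonal q.derivative p))
      (fun p => -2 * m * coordU p ^ (m - 1) * (p.1 2 : ℂ) * zonal q p +
        coordU p ^ m * (conj (coordU p) * zonal q.derivative p)) :=
  ((hasLadder_coordU_pow m).mul (hasLadder_zonal q)).congr (fun _ => rfl) (fun p => by ring)
    (fun p => by ring)

/-! ### The Legendre equation and the normalized harmonics. -/

/-- The Legendre differential equation for the derivatives of `(X² - 1)^l`. -/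
theorem legendre_ode (l k : ℕ) :
    (Polynomial.X ^ 2 - 1) * Polynomial.derivative^[k + 2]
        ((Polynomial.X ^ 2 - 1) ^ l : Polynomial ℝ) +
      2 * ((k : Polynomial ℝ) + 1 - (l : Polynomial ℝ)) * Polynomial.X *
        Polynomial.derivative^[k + 1] ((Polynomial.X ^ 2 - 1) ^ l) =
      ((k : Polynomial ℝ) + 1) * (2 * (l : Polynomial ℝ) - (k : Polynomial ℝ)) *
        Polynomial.derivative^[k] ((Polynomial.X ^ 2 - 1) ^ l) := by
  induction k with
  | zero =>
    -- The first-order equation satisfied by `w = (X² - 1)^l`. One differentiation gives the case `k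
    -- = 0`, and each further one raises `k` by one.
    have h1 : (Polynomial.X ^ 2 - 1) * Polynomial.derivative
        ((Polynomial.X ^ 2 - 1) ^ l : Polynomial ℝ) =
        2 * (l : Polynomial ℝ) * Polynomial.X * (Polynomial.X ^ 2 - 1) ^ l := by
      rcases l with _ | l
      · simp
      · rw [Polynomial.derivative_pow_succ]
        simp [Polynomial.C_add]
        ring
    have h2 := congrArg Polynomial.derivative h1
    simp only [Polynomial.derivative_mul, Polynomial.derivative_sub, Polynomial.derivative_X_sq,
      Polynomial.derivative_one, Polynomial.derivative_natCast, Polynomial.derivative_ofNat,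
      Polynomial.derivative_X, map_ofNat] at h2
    simp only [Function.iterate_succ_apply', Function.iterate_zero_apply, zero_add, Nat.cast_zero]
    linear_combination h2
  | succ k ih =>
    have h2 := congrArg Polynomial.derivative ih
    simp only [Polynomial.derivative_mul, Polynomial.derivative_sub, Polynomial.derivative_add,
      Polynomial.derivative_X_sq,
      Polynomial.derivative_one, Polynomial.derivative_natCast, Polynomial.derivative_ofNat,
      Polynomial.derivative_X, map_ofNat, ← Function.iterate_succ_apply'] at h2
    push_cast
    linear_combination h2

/-- The eigenvalue `√((l-m)(l+m+1))` of the ladder operators. -/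
noncomputable def ladderCoeff (l : ℕ) (m : ℤ) : ℝ := Real.sqrt ((l - m) * (l + m + 1))

/-- The reflection exchanges the two factors under the root. It matches raising at a negative index
with lowering at the opposite one. -/
theorem ladderCoeff_neg (l : ℕ) (m : ℤ) : ladderCoeff l (-m - 1) = ladderCoeff l m := by
  unfold ladderCoeff
  congr 1
  push_cast
  ring

theorem ladderCoeff_sq {l : ℕ} {m : ℤ} (h1 : -l ≤ m + 1) (h2 : m ≤ l) :
    ladderCoeff l m ^ 2 = (l - m) * (l + m + 1) := by
  have h1' : -(l : ℝ) ≤ m + 1 := by exact_mod_cast h1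
  have h2' : (m : ℝ) ≤ l := by exact_mod_cast h2
  exact Real.sq_sqrt (mul_nonneg (by linarith) (by linarith))

/-- The polynomial `(d/dt)^k (t² - 1)^l`. -/
noncomputable def rodrigues (l k : ℕ) : Polynomial ℝ :=
  Polynomial.derivative^[k] ((Polynomial.X ^ 2 - 1) ^ l)

theorem derivative_rodrigues (l k : ℕ) :
    (rodrigues l k).derivative = rodrigues l (k + 1) := by
  rw [rodrigues, rodrigues, Function.iterate_succ_apply']

/-- The normalization constant of the spherical harmonics. -/
noncomputable def harmonicNorm (l m : ℕ) : ℝ :=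
  Real.sqrt ((2 * l + 1) / (4 * Real.pi) * ((l - m).factorial / (l + m).factorial)) *
    (-1) ^ m * (1 / (2 ^ l * l.factorial))

theorem sphericalHarmonicNat_eq (l m : ℕ) (p : S2) :
    sphericalHarmonicNat l m p =
      harmonicNorm l m * (coordU p ^ m * zonal (rodrigues l (l + m)) p) := by
  simp only [sphericalHarmonicNat, harmonicNorm, zonal, rodrigues, coordU]
  push_cast
  ring

theorem harmonicNorm_succ {l m : ℕ} (h : m < l) :
    harmonicNorm l m = -(ladderCoeff l m * harmonicNorm l (m + 1)) := by
  have hm : (m : ℝ) < l := by exact_mod_cast h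
  have e : (2 * (l : ℝ) + 1) / (4 * Real.pi) * ((l - m).factorial / (l + m).factorial) =
      ((l - m) * (l + m + 1)) * ((2 * (l : ℝ) + 1) / (4 * Real.pi) *
        ((l - (m + 1)).factorial / (l + (m + 1)).factorial)) := by
    obtain ⟨k, rfl⟩ := Nat.exists_eq_add_of_lt h
    rw [show m + k + 1 - m = k + 1 by omega, show m + k + 1 - (m + 1) = k by omega,
      ← add_assoc (m + k + 1) m 1, Nat.factorial_succ k, Nat.factorial_succ (m + k + 1 + m)]
    have h1 : ((m + k + 1 + m).factorial : ℝ) ≠ 0 := by positivity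
    have h2 : (m : ℝ) + k + 1 + m + 1 ≠ 0 := by positivity
    push_cast
    field_simp
    ring
  unfold harmonicNorm ladderCoeff
  rw [e, Real.sqrt_mul (mul_nonneg (by linarith) (by positivity))]
  push_cast
  ring

theorem rodrigues_eq_zero {l k : ℕ} (h : 2 * l < k) : rodrigues l k = 0 := by
  refine Polynomial.iterate_derivative_eq_zero (lt_of_le_of_lt ?_ h)
  refine Polynomial.natDegree_pow_le.trans ?_
  rw [mul_comm]
  gcongr
  exact (Polynomial.natDegree_X_pow_sub_C (R := ℝ) (n := 2) (r := 1)).le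

theorem sphericalHarmonicNat_eq_zero {l m : ℕ} (h : l < m) (p : S2) :
    sphericalHarmonicNat l m p = 0 := by
  rw [sphericalHarmonicNat_eq, rodrigues_eq_zero (by omega)]
  simp [zonal]

/-- Raising trades a derivative of the zonal factor for a power of `x + iy`. At `m = l` both sides
vanish, since `(t² - 1)^l` has degree `2l` and is differentiated `2l + 1` times. -/
theorem raise_sphericalHarmonicNat {l m : ℕ} (h : m ≤ l) (p : S2) :
    (harmonicNorm l m : ℂ) * -(coordU p ^ (m + 1) * zonal (rodrigues l (l + m)).derivative p) =
      ladderCoeff l m * sphericalHarmonicNat l (m + 1) p := by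
  rcases h.eq_or_lt with rfl | h
  · rw [sphericalHarmonicNat_eq_zero (Nat.lt_succ_self _), derivative_rodrigues,
      rodrigues_eq_zero (by omega)]
    simp [zonal]
  · rw [sphericalHarmonicNat_eq, harmonicNorm_succ h, derivative_rodrigues]
    push_cast
    rw [add_assoc]
    ring

/-- Since `Y_l^0` is real, lowering it is minus the conjugate of raising it; this avoids index `-1`
in the natural-number family. -/
theorem hasLadder_sphericalHarmonicNat_zero (l : ℕ) :
    HasLadder (sphericalHarmonicNat l 0) (fun p => ladderCoeff l 0 * sphericalHarmonicNat l 1 p)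
      (fun p => ladderCoeff l 0 * -conj (sphericalHarmonicNat l 1 p)) := by
  have h := (hasLadder_coordU_pow_mul_zonal 0 (rodrigues l (l + 0))).const_mul (harmonicNorm l 0)
  have e := raise_sphericalHarmonicNat (Nat.zero_le l)
  push_cast at e
  refine h.congr (sphericalHarmonicNat_eq l 0) (fun p => (e p).symm) (fun p => ?_)
  have e' := congrArg conj (e p)
  simp only [map_mul, map_neg, map_pow, conj_zonal, Complex.conj_ofReal] at e'
  push_cast
  linear_combination e'

/-- The Legendre equation with `k = l + m`: its right-hand coefficient `(k + 1)(2l - k)` is the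
square of the ladder coefficient. -/
theorem zonal_legendre (l m : ℕ) (hm : m < l) (p : S2) :
    -2 * (m + 1) * (p.1 2 : ℂ) * zonal (rodrigues l (l + m + 1)) p +
      (1 - (p.1 2 : ℂ) ^ 2) * zonal (rodrigues l (l + m + 2)) p =
      -(ladderCoeff l m) ^ 2 * zonal (rodrigues l (l + m)) p := by
  have h := congrArg (fun q => zonal q p) (legendre_ode l (l + m))
  have hs : ((ladderCoeff l m : ℂ)) ^ 2 = (l - m) * (l + m + 1) := by
    have := ladderCoeff_sq (l := l) (m := m) (by omega) (by omega)
    exact_mod_cast this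
  rw [hs]
  simp only [zonal, rodrigues, Polynomial.eval_add, Polynomial.eval_mul, Polynomial.eval_sub,
    Polynomial.eval_pow, Polynomial.eval_X, Polynomial.eval_one, Polynomial.eval_natCast,
    Polynomial.eval_ofNat] at h ⊢
  push_cast at h ⊢
  linear_combination -h

/-- For the lowering half, the product rule produces `(x + iy)(x - iy) = 1 - z²`, which turns the
result into the left side of `zonal_legendre`. -/
theorem hasLadder_sphericalHarmonicNat_succ {l m : ℕ} (hm : m < l) :
    HasLadder (sphericalHarmonicNat l (m + 1))
      (fun p => ladderCoeff l (m + 1) * sphericalHarmonicNat l (m + 2) p)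
      (fun p => ladderCoeff l m * sphericalHarmonicNat l m p) := by
  have h := (hasLadder_coordU_pow_mul_zonal (m + 1) (rodrigues l (l + (m + 1)))).const_mul
    (harmonicNorm l (m + 1))
  have e := raise_sphericalHarmonicNat (Nat.succ_le_of_lt hm)
  push_cast at e
  refine h.congr (sphericalHarmonicNat_eq l (m + 1)) (fun p => (e p).symm) (fun p => ?_)
  have e1 := zonal_legendre l m hm p
  rw [sphericalHarmonicNat_eq, harmonicNorm_succ hm, derivative_rodrigues, Nat.add_sub_cancel,
    ← add_assoc, add_assoc (l + m) 1 1]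
  have e2 := coordU_mul_conj p
  push_cast
  linear_combination (-(harmonicNorm l (m + 1) : ℂ) * coordU p ^ m) * e1
    - (harmonicNorm l (m + 1) : ℂ) * coordU p ^ m * zonal (rodrigues l (l + m + 2)) p * e2

/-! ### Harmonics of arbitrary integer index. -/

theorem sphericalHarmonic_natCast (l m : ℕ) (p : S2) :
    sphericalHarmonic l m p = sphericalHarmonicNat l m p := by
  simp [sphericalHarmonic]

theorem conj_sphericalHarmonicNat_zero (l : ℕ) (p : S2) :
    conj (sphericalHarmonicNat l 0 p) = sphericalHarmonicNat l 0 p := by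
  simp [sphericalHarmonicNat_eq, conj_zonal]

theorem sphericalHarmonic_neg_natCast (l m : ℕ) (p : S2) :
    sphericalHarmonic l (-(m : ℤ)) p = (-1) ^ m * conj (sphericalHarmonicNat l m p) := by
  rcases m.eq_zero_or_pos with rfl | h
  · simp [sphericalHarmonic, conj_sphericalHarmonicNat_zero]
  · rw [sphericalHarmonic, if_neg (by omega), Int.natAbs_neg, Int.natAbs_natCast]

theorem sphericalHarmonic_eq_zero {l : ℕ} {m : ℤ} (h : (l : ℤ) < |m|) (p : S2) :
    sphericalHarmonic l m p = 0 := by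
  rw [lt_abs] at h
  have := sphericalHarmonicNat_eq_zero (l := l) (m := m.natAbs) (by omega) p
  simp [sphericalHarmonic, this]

theorem hasLadder_sphericalHarmonic_of_abs_le {l : ℕ} {m : ℤ} (h : |m| ≤ l) :
    HasLadder (sphericalHarmonic l m) (fun p => ladderCoeff l m * sphericalHarmonic l (m + 1) p)
      (fun p => ladderCoeff l (m - 1) * sphericalHarmonic l (m - 1) p) := by
  rw [abs_le] at h
  rcases Int.eq_nat_or_neg m with ⟨n, rfl | rfl⟩ <;> rcases n with _ | n
  · have e : ladderCoeff l (-1) = ladderCoeff l 0 := by simpa using ladderCoeff_neg l 0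
    refine (hasLadder_sphericalHarmonicNat_zero l).congr (sphericalHarmonic_natCast l 0)
      (fun p => ?_) (fun p => ?_)
    · simpa using Or.inl (sphericalHarmonic_natCast l 1 p)
    · have := sphericalHarmonic_neg_natCast l 1 p
      simp only [Nat.cast_one, pow_one] at this
      simp [e, this]
  · refine (hasLadder_sphericalHarmonicNat_succ (l := l) (m := n) (by omega)).congr
      (sphericalHarmonic_natCast l _) (fun p => ?_) (fun p => ?_)
    · rw [← sphericalHarmonic_natCast]
      push_cast
      rw [add_assoc]
      rfl
    · rw [← sphericalHarmonic_natCast]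
      push_cast
      rw [add_sub_cancel_right]
  -- Index zero again, now as the negative of the natural number zero.
  · have e : ladderCoeff l (-1) = ladderCoeff l 0 := by simpa using ladderCoeff_neg l 0
    refine (hasLadder_sphericalHarmonicNat_zero l).congr (sphericalHarmonic_natCast l 0)
      (fun p => ?_) (fun p => ?_)
    · simpa using Or.inl (sphericalHarmonic_natCast l 1 p)
    · have := sphericalHarmonic_neg_natCast l 1 p
      simp only [Nat.cast_one, pow_one] at this
      simp [e, this]
  · refine ((hasLadder_sphericalHarmonicNat_succ (l := l) (m := n) (by omega)).star.const_mul
      ((-1) ^ (n + 1))).congr (sphericalHarmonic_neg_natCast l _) (fun p => ?_) (fun p => ?_)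
    · rw [show -((n + 1 : ℕ) : ℤ) + 1 = -(n : ℤ) by push_cast; ring,
        sphericalHarmonic_neg_natCast, show -((n + 1 : ℕ) : ℤ) = -(n : ℤ) - 1 by push_cast; ring,
        ladderCoeff_neg, map_mul, Complex.conj_ofReal]
      ring
    · rw [show -((n + 1 : ℕ) : ℤ) - 1 = -((n + 2 : ℕ) : ℤ) by push_cast; ring,
        sphericalHarmonic_neg_natCast,
        show -((n + 2 : ℕ) : ℤ) = -((n : ℤ) + 1) - 1 by push_cast; ring,
        ladderCoeff_neg, map_mul, Complex.conj_ofReal]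
      ring

/-- Outside `|m| ≤ l` the harmonic is zero. A neighbour can be nonzero only for `m = -l - 1` or `m =
l + 1`, and there the ladder coefficient vanishes. The relations below thus need no range
conditions. -/
theorem hasLadder_sphericalHarmonic (l : ℕ) (m : ℤ) :
    HasLadder (sphericalHarmonic l m) (fun p => ladderCoeff l m * sphericalHarmonic l (m + 1) p)
      (fun p => ladderCoeff l (m - 1) * sphericalHarmonic l (m - 1) p) := by
  rcases le_or_gt |m| (l : ℤ) with h | h
  · exact hasLadder_sphericalHarmonic_of_abs_le h
  · refine (HasLadder.const 0).congr (sphericalHarmonic_eq_zero h) (fun p => ?_) (fun p => ?_)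
    · rcases eq_or_ne m (-(l : ℤ) - 1) with rfl | h'
      · have : ladderCoeff l (-(l : ℤ) - 1) = 0 := by
          rw [ladderCoeff_neg]
          simp [ladderCoeff]
        simp [this]
      · rw [sphericalHarmonic_eq_zero (by rw [lt_abs] at h ⊢; omega), mul_zero]
    · rcases eq_or_ne m ((l : ℤ) + 1) with rfl | h'
      · simp [ladderCoeff]
      · rw [sphericalHarmonic_eq_zero (by rw [lt_abs] at h ⊢; omega), mul_zero]

theorem continuous_sphericalHarmonic (l : ℕ) (m : ℤ) : Continuous (sphericalHarmonic l m) :=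
  (hasLadder_sphericalHarmonic l m).cont

/-! ### Schur's lemma for rotation invariant forms -/

section Schur

variable {N : ℕ} {μ : Measure (Fin N → S2)} [IsFiniteMeasure μ]

theorem IsRotationInvariant.covForm_raise (hμ : IsRotationInvariant μ) (l l' : ℕ) (m n : ℤ) :
    ladderCoeff l m * covForm μ (sphericalHarmonic l (m + 1)) (sphericalHarmonic l' (n + 1)) =
      ladderCoeff l' n * covForm μ (sphericalHarmonic l m) (sphericalHarmonic l' n) := by
  have h := (hμ.covForm_adjoint (hasLadder_sphericalHarmonic l m)
    (hasLadder_sphericalHarmonic l' (n + 1))).1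
  rw [covForm_const_mul_left, covForm_const_mul_right, Complex.conj_ofReal] at h
  simpa only [add_sub_cancel_right] using h

theorem IsRotationInvariant.covForm_lower (hμ : IsRotationInvariant μ) (l l' : ℕ) (m n : ℤ) :
    ladderCoeff l m * covForm μ (sphericalHarmonic l m) (sphericalHarmonic l' n) =
      ladderCoeff l' n *
        covForm μ (sphericalHarmonic l (m + 1)) (sphericalHarmonic l' (n + 1)) := by
  have h := (hμ.covForm_adjoint (hasLadder_sphericalHarmonic l (m + 1))
    (hasLadder_sphericalHarmonic l' n)).2
  rw [covForm_const_mul_left, covForm_const_mul_right, Complex.conj_ofReal] at h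
  simpa only [add_sub_cancel_right] using h

/-- Raising then lowering, and lowering then raising, are self-adjoint for the form and act on
harmonics by scalars. If the form is nonzero on a pair, both scalars agree for its two members. -/
theorem IsRotationInvariant.covForm_eq_zero (hμ : IsRotationInvariant μ) {l l' : ℕ} {m n : ℤ}
    (hm : |m| ≤ l) (hn : |n| ≤ l') (hne : (l, m) ≠ (l', n)) :
    covForm μ (sphericalHarmonic l m) (sphericalHarmonic l' n) = 0 := by
  rw [abs_le] at hm hn
  have key : ∀ a b : ℝ, (a : ℂ) ^ 2 * covForm μ (sphericalHarmonic l m) (sphericalHarmonic l' n) =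
      (b : ℂ) ^ 2 * covForm μ (sphericalHarmonic l m) (sphericalHarmonic l' n) → a ^ 2 ≠ b ^ 2 →
      covForm μ (sphericalHarmonic l m) (sphericalHarmonic l' n) = 0 := by
    intro a b h hab
    by_contra h0
    exact hab (by exact_mod_cast mul_right_cancel₀ h0 h)
  have e1 : (ladderCoeff l m : ℂ) ^ 2 *
      covForm μ (sphericalHarmonic l m) (sphericalHarmonic l' n) = (ladderCoeff l' n : ℂ) ^ 2 *
      covForm μ (sphericalHarmonic l m) (sphericalHarmonic l' n) := by
    linear_combination (ladderCoeff l m : ℂ) * hμ.covForm_lower l l' m n +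
      (ladderCoeff l' n : ℂ) * hμ.covForm_raise l l' m n
  have e2 : (ladderCoeff l (m - 1) : ℂ) ^ 2 *
      covForm μ (sphericalHarmonic l m) (sphericalHarmonic l' n) = (ladderCoeff l' (n - 1) : ℂ) ^ 2 *
      covForm μ (sphericalHarmonic l m) (sphericalHarmonic l' n) := by
    have r := hμ.covForm_raise l l' (m - 1) (n - 1)
    have s := hμ.covForm_lower l l' (m - 1) (n - 1)
    simp only [sub_add_cancel] at r s
    linear_combination (ladderCoeff l (m - 1) : ℂ) * r + (ladderCoeff l' (n - 1) : ℂ) * s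
  by_contra h0
  have f1 : (ladderCoeff l m) ^ 2 = (ladderCoeff l' n) ^ 2 := not_not.1 fun h => h0 (key _ _ e1 h)
  have f2 : (ladderCoeff l (m - 1)) ^ 2 = (ladderCoeff l' (n - 1)) ^ 2 :=
    not_not.1 fun h => h0 (key _ _ e2 h)
  rw [ladderCoeff_sq (by omega) (by omega), ladderCoeff_sq (by omega) (by omega)] at f1 f2
  push_cast at f2
  -- The two scalars for `(l, m)` differ by `2m`, so subtracting `f1` from `f2` gives `m = n`; what
  -- remains is `l(l+1) = l'(l'+1)`.
  have hmn : (m : ℝ) = n := by nlinarith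
  have hll : (l : ℝ) = l' := by
    rw [hmn] at f1
    have : ((l : ℝ) - l') * (l + l' + 1) = 0 := by linear_combination f1
    rcases mul_eq_zero.1 this with h | h
    · linarith
    · exact absurd h (by positivity)
  exact hne (Prod.ext (by exact_mod_cast hll) (by exact_mod_cast hmn))

/-- For equal indices the raising relation has the same coefficient on both sides, and it is
positive while `m < l`. Induction climbs from `m` to `l`. -/
theorem IsRotationInvariant.covForm_self_eq (hμ : IsRotationInvariant μ) {l : ℕ} {m : ℤ}
    (hm : |m| ≤ l) :
    covForm μ (sphericalHarmonic l m) (sphericalHarmonic l m) =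
      covForm μ (sphericalHarmonic l l) (sphericalHarmonic l l) := by
  rw [abs_le] at hm
  obtain ⟨k, hk⟩ := Int.eq_ofNat_of_zero_le (sub_nonneg.2 hm.2)
  induction k generalizing m with
  | zero => rw [show m = l by omega]
  | succ k ih =>
    rw [← ih (m := m + 1) (by omega) (by omega)]
    have h := hμ.covForm_raise l l m m
    refine (mul_left_cancel₀ ?_ h).symm
    have h1 : (m : ℝ) < l := by exact_mod_cast (show m < l by omega)
    have h2 : -(l : ℝ) ≤ m := by exact_mod_cast hm.1
    exact Complex.ofReal_ne_zero.2 (Real.sqrt_pos.2 (mul_pos (by linarith) (by linarith))).ne'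

/-- For `l > 0` every harmonic is in the range of a ladder operator: `m = -l` is reached by
lowering, every other index by raising. -/
theorem IsRotationInvariant.integral_sphericalHarmonic (hμ : IsRotationInvariant μ) {l : ℕ}
    (hl : 0 < l) {m : ℤ} (hm : |m| ≤ l) (i : Fin N) :
    ∫ S, sphericalHarmonic l m (S i) ∂μ = 0 := by
  rw [abs_le] at hm
  rcases hm.1.eq_or_lt with h | h
  · have h1 := (hμ.integral_ladder (hasLadder_sphericalHarmonic l (m + 1)) i).2
    rw [integral_const_mul, add_sub_cancel_right] at h1
    refine (mul_eq_zero.1 h1).resolve_left (Complex.ofReal_ne_zero.2 (Real.sqrt_pos.2 ?_).ne')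
    rw [← h]
    have : (0 : ℝ) < l := by exact_mod_cast hl
    push_cast
    nlinarith
  · have h1 := (hμ.integral_ladder (hasLadder_sphericalHarmonic l (m - 1)) i).1
    rw [integral_const_mul, sub_add_cancel] at h1
    refine (mul_eq_zero.1 h1).resolve_left (Complex.ofReal_ne_zero.2 (Real.sqrt_pos.2 ?_).ne')
    have h2 : (m : ℝ) ≤ l := by exact_mod_cast hm.2
    have h3 : -(l : ℝ) < m := by exact_mod_cast h
    push_cast
    exact mul_pos (by linarith) (by linarith)

end Schur

/-! ### Orthonormality -/

theorem isRotationInvariant_tupleMeasure (N : ℕ) : IsRotationInvariant (tupleMeasure N) :=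
  fun γ => measurePreserving_rotateTuple γ

/-- Identifying one-tuples with points lets the results on invariant measures apply to the sphere
itself. -/
theorem integral_tupleMeasure_one (f : S2 → ℂ) :
    ∫ S, f (S 0) ∂tupleMeasure 1 = ∫ p, f p ∂surfaceMeasure :=
  (measurePreserving_funUnique surfaceMeasure (Fin 1)).integral_comp
    (MeasurableEquiv.measurableEmbedding _) f

theorem covForm_tupleMeasure_one (f g : S2 → ℂ) :
    covForm (tupleMeasure 1) f g = ∫ p, f p * conj (g p) ∂surfaceMeasure := by
  rw [← integral_tupleMeasure_one, covForm]
  simp [MC]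

theorem integral_coordU_mul_conj_pow (j : ℕ) :
    ∫ p, (coordU p * conj (coordU p)) ^ j ∂surfaceMeasure =
      4 * Real.pi * ((2 ^ j * j.factorial) ^ 2 / (2 * j + 1).factorial) := by
  induction j with
  | zero => simpa using integral_const_surfaceMeasure 1
  | succ j ih =>
    -- With `U = x + iy`, the raised image of `conj(U)^(j+1) U^j z` has integral zero. Using `z² = 1
    -- - |U|²`, this is the recursion `(2j+3) I_(j+1) = 2(j+1) I_j`.
    have h := ((isRotationInvariant_tupleMeasure 1).integral_ladder
      (((hasLadder_coordU_pow (j + 1)).star.mul (hasLadder_coordU_pow j)).mul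
        (hasLadder_zonal Polynomial.X)) 0).1
    have hc : ∀ k, Integrable (fun p => (coordU p * conj (coordU p)) ^ k) surfaceMeasure :=
      fun k => integrable_of_continuous ((continuous_coordU.mul continuous_conj_coordU).pow k)
    rw [integral_tupleMeasure_one (fun p => (-conj (-2 * ((j + 1 : ℕ) : ℂ) *
      coordU p ^ (j + 1 - 1) * (p.1 2 : ℂ)) * coordU p ^ j + conj (coordU p ^ (j + 1)) * 0) *
      zonal Polynomial.X p + conj (coordU p ^ (j + 1)) * coordU p ^ j *
      -(coordU p * zonal (Polynomial.derivative Polynomial.X) p))] at h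
    have e : ∀ p : S2, (-conj (-2 * ((j + 1 : ℕ) : ℂ) *
        coordU p ^ (j + 1 - 1) * (p.1 2 : ℂ)) * coordU p ^ j + conj (coordU p ^ (j + 1)) * 0) *
        zonal Polynomial.X p + conj (coordU p ^ (j + 1)) * coordU p ^ j *
        -(coordU p * zonal (Polynomial.derivative Polynomial.X) p) =
        2 * (j + 1) * (coordU p * conj (coordU p)) ^ j -
          (2 * j + 3) * (coordU p * conj (coordU p)) ^ (j + 1) := by
      intro p
      have h2 := coordU_mul_conj p
      have h1 : zonal 1 p = 1 := by simp [zonal]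
      rw [zonal_X, Polynomial.derivative_X, h1, Nat.add_sub_cancel]
      simp only [map_mul, map_neg, map_pow, Complex.conj_ofReal, map_natCast, map_ofNat]
      push_cast
      simp only [pow_succ, mul_pow]
      linear_combination (2 * (j + 1) * conj (coordU p) ^ j * coordU p ^ j) * h2
    simp only [e] at h
    rw [integral_sub ((hc _).const_mul _) ((hc _).const_mul _), integral_const_mul,
      integral_const_mul, ih] at h
    have h3 : (2 * (j : ℂ) + 3) ≠ 0 := by exact_mod_cast (show 2 * j + 3 ≠ 0 by omega)
    have h5 : ((2 * j + 1).factorial : ℂ) ≠ 0 := by exact_mod_cast Nat.factorial_ne_zero _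
    refine mul_left_cancel₀ h3 ?_
    rw [show 2 * (j + 1) + 1 = 2 * j + 1 + 1 + 1 by ring, Nat.factorial_succ (2 * j + 1 + 1),
      Nat.factorial_succ (2 * j + 1), Nat.factorial_succ j]
    have h6 : (((2 * j + 1 + 1 + 1 : ℕ) : ℂ)) = 2 * j + 3 := by push_cast; ring
    have h7 : (((2 * j + 1 + 1 : ℕ) : ℂ)) = 2 * j + 2 := by push_cast; ring
    rw [Nat.cast_mul (2 * j + 1 + 1 + 1), Nat.cast_mul (2 * j + 1 + 1), h6, h7, ← sub_eq_zero.1 h]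
    push_cast
    field_simp
    ring

theorem natDegree_sq_sub_one_pow (l : ℕ) :
    ((Polynomial.X ^ 2 - 1 : Polynomial ℝ) ^ l).natDegree = 2 * l := by
  have : (Polynomial.X ^ 2 - 1 : Polynomial ℝ).natDegree = 2 :=
    Polynomial.natDegree_X_pow_sub_C (R := ℝ) (n := 2) (r := 1)
  rw [Polynomial.natDegree_pow, this, mul_comm]

theorem coeff_rodrigues {l k : ℕ} (hk : k ≤ 2 * l) :
    (rodrigues l k).coeff (2 * l - k) = (2 * l).descFactorial k := by
  have hm : ((Polynomial.X ^ 2 - 1 : Polynomial ℝ) ^ l).Monic :=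
    (Polynomial.monic_X_pow_sub_C (1 : ℝ) two_ne_zero).pow l
  have hc : ((Polynomial.X ^ 2 - 1 : Polynomial ℝ) ^ l).coeff (2 * l) = 1 := by
    rw [← natDegree_sq_sub_one_pow l]
    exact hm
  rw [rodrigues, Polynomial.coeff_iterate_derivative, Nat.sub_add_cancel hk, hc]
  simp

theorem natDegree_rodrigues_le (l k : ℕ) : (rodrigues l k).natDegree ≤ 2 * l - k :=
  (Polynomial.natDegree_iterate_derivative _ _).trans_eq (by rw [natDegree_sq_sub_one_pow])

theorem rodrigues_two_mul (l : ℕ) : rodrigues l (l + l) = Polynomial.C ((2 * l).factorial : ℝ) := by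
  have h := natDegree_rodrigues_le l (2 * l)
  rw [Nat.sub_self] at h
  have h2 := coeff_rodrigues (le_refl (2 * l))
  rw [Nat.sub_self, Nat.descFactorial_self] at h2
  rw [← two_mul, Polynomial.eq_C_of_natDegree_le_zero h, h2]

/-- `Y_l^l` is a constant times `(x + iy)^l`, so its norm is an explicit integral; the other indices
follow from `covForm_self_eq`. -/
theorem covForm_sphericalHarmonic_top (l : ℕ) :
    covForm (tupleMeasure 1) (sphericalHarmonic l l) (sphericalHarmonic l l) = 1 := by
  have e : ∀ p, sphericalHarmonic l l p * conj (sphericalHarmonic l l p) =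
      ((harmonicNorm l l * (2 * l).factorial : ℝ) : ℂ) ^ 2 *
        (coordU p * conj (coordU p)) ^ l := by
    intro p
    rw [sphericalHarmonic_natCast, sphericalHarmonicNat_eq, rodrigues_two_mul]
    simp only [zonal, Polynomial.eval_C, map_mul, map_pow, Complex.conj_ofReal]
    push_cast
    ring
  rw [covForm_tupleMeasure_one]
  simp only [e]
  rw [integral_const_mul, integral_coordU_mul_conj_pow]
  have e2 : (harmonicNorm l l * (2 * l).factorial) ^ 2 *
      (4 * Real.pi * ((2 ^ l * l.factorial) ^ 2 / (2 * l + 1).factorial)) = 1 := by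
    have h1 : ((2 * l).factorial : ℝ) ≠ 0 := by positivity
    have h2 : (l.factorial : ℝ) ≠ 0 := by positivity
    have h3 : (2 * (l : ℝ) + 1) ≠ 0 := by positivity
    have h4 := Real.pi_ne_zero
    rw [harmonicNorm, mul_pow, mul_pow, mul_pow, Real.sq_sqrt (by positivity), ← pow_mul,
      mul_comm l 2, pow_mul, neg_one_sq, one_pow, ← two_mul, Nat.sub_self, Nat.factorial_zero,
      Nat.factorial_succ]
    push_cast
    field_simp
  have e3 := congrArg Complex.ofReal e2
  push_cast at e3 ⊢
  exact e3

theorem integral_sphericalHarmonic_mul_conj {l l' : ℕ} {m n : ℤ} (hm : |m| ≤ l) (hn : |n| ≤ l') :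
    ∫ p, sphericalHarmonic l m p * conj (sphericalHarmonic l' n p) ∂surfaceMeasure =
      if (l, m) = (l', n) then 1 else 0 := by
  rw [← covForm_tupleMeasure_one]
  split_ifs with h
  · obtain ⟨rfl, rfl⟩ := Prod.mk.inj h
    rw [(isRotationInvariant_tupleMeasure 1).covForm_self_eq hm, covForm_sphericalHarmonic_top]
  · exact (isRotationInvariant_tupleMeasure 1).covForm_eq_zero hm hn h

/-! ### Completeness -/

/-- The index set of the spherical harmonics: pairs `(l, m)` with `-l ≤ m ≤ l`. -/
abbrev HarmonicIndex : Type := (l : ℕ) × Finset.Icc (-(l : ℤ)) (l : ℤ)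

theorem HarmonicIndex.abs_le (i : HarmonicIndex) : |(i.2 : ℤ)| ≤ i.1 :=
  _root_.abs_le.2 (Finset.mem_Icc.1 i.2.2)

/-- The spherical harmonics as continuous maps. -/
noncomputable def harmonicMap (l : ℕ) (m : ℤ) : C(S2, ℂ) :=
  ⟨sphericalHarmonic l m, continuous_sphericalHarmonic l m⟩

/-- The span of the spherical harmonics in the space of continuous functions. -/
noncomputable def harmonicSpan : Submodule ℂ C(S2, ℂ) :=
  Submodule.span ℂ (Set.range fun i : HarmonicIndex => harmonicMap i.1 i.2)

theorem harmonicMap_mem_harmonicSpan (l : ℕ) (m : ℤ) : harmonicMap l m ∈ harmonicSpan := by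
  rcases le_or_gt |m| (l : ℤ) with h | h
  · exact Submodule.subset_span ⟨⟨l, m, Finset.mem_Icc.2 (abs_le.1 h)⟩, rfl⟩
  · rw [show harmonicMap l m = 0 from ContinuousMap.ext (sphericalHarmonic_eq_zero h)]
    exact Submodule.zero_mem _

theorem conj_sphericalHarmonic (l : ℕ) (m : ℤ) (p : S2) :
    conj (sphericalHarmonic l m p) = (-1) ^ m.natAbs * sphericalHarmonic l (-m) p := by
  have h1 : ∀ n : ℕ, ((-1 : ℂ) ^ n) * (-1) ^ n = 1 := fun n => by rw [← mul_pow]; simp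
  rcases Int.eq_nat_or_neg m with ⟨n, rfl | rfl⟩
  · rw [sphericalHarmonic_neg_natCast, sphericalHarmonic_natCast, Int.natAbs_natCast, ← mul_assoc,
      h1, one_mul]
  · rw [sphericalHarmonic_neg_natCast, neg_neg, sphericalHarmonic_natCast, Int.natAbs_neg,
      Int.natAbs_natCast]
    simp

theorem star_mem_harmonicSpan {f : C(S2, ℂ)} (hf : f ∈ harmonicSpan) : star f ∈ harmonicSpan := by
  refine Submodule.span_induction ?_ ?_ ?_ ?_ hf
  · rintro _ ⟨i, rfl⟩
    have : star (harmonicMap i.1 i.2) = ((-1) ^ (i.2 : ℤ).natAbs : ℂ) • harmonicMap i.1 (-i.2) :=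
      ContinuousMap.ext fun p => conj_sphericalHarmonic i.1 i.2 p
    simp only [this]
    exact Submodule.smul_mem _ _ (harmonicMap_mem_harmonicSpan _ _)
  · rw [star_zero]
    exact Submodule.zero_mem _
  · intro f g _ _ hf hg
    rw [star_add]
    exact Submodule.add_mem _ hf hg
  · intro c f _ hf
    rw [star_smul]
    exact Submodule.smul_mem _ _ hf

theorem continuous_zonal (q : Polynomial ℝ) : Continuous (zonal q) := (hasLadder_zonal q).cont

/-- The restriction to the sphere of `(x + iy)^m (x - iy)^n q(z)`. -/
noncomputable def polyMap (m n : ℕ) (q : Polynomial ℝ) : C(S2, ℂ) :=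
  ⟨fun p => coordU p ^ m * conj (coordU p) ^ n * zonal q p,
    ((continuous_coordU.pow m).mul (continuous_conj_coordU.pow n)).mul (continuous_zonal q)⟩

theorem polyMap_mul (m n m' n' : ℕ) (q r : Polynomial ℝ) :
    polyMap m n q * polyMap m' n' r = polyMap (m + m') (n + n') (q * r) := by
  ext p
  simp only [polyMap, ContinuousMap.mul_apply, ContinuousMap.coe_mk, zonal_mul]
  ring

theorem polyMap_zero : polyMap 0 0 1 = 1 := by
  ext p
  simp [polyMap, zonal]

theorem star_polyMap (m n : ℕ) (q : Polynomial ℝ) : star (polyMap m n q) = polyMap n m q := by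
  ext p
  simp only [polyMap, ContinuousMap.star_apply, ContinuousMap.coe_mk, RCLike.star_def, map_mul,
    map_pow, Complex.conj_conj, conj_zonal]
  ring

/-- The polynomials `(d/dt)^(l+m) (t² - 1)^l`, `l = m, m + 1, …`. -/
noncomputable def rodriguesSequence (m : ℕ) : Polynomial.Sequence ℝ where
  elems' d := rodrigues (m + d) (m + d + m)
  degree_eq' d := by
    have h1 := natDegree_rodrigues_le (m + d) (m + d + m)
    have h2 := coeff_rodrigues (l := m + d) (k := m + d + m) (by omega)
    rw [show 2 * (m + d) - (m + d + m) = d by omega] at h1 h2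
    refine Polynomial.degree_eq_of_le_of_coeff_ne_zero
      (Polynomial.natDegree_le_iff_degree_le.1 h1) ?_
    rw [h2]
    exact_mod_cast (Nat.descFactorial_pos.2 (by omega)).ne'

theorem harmonicNorm_ne_zero (l m : ℕ) : harmonicNorm l m ≠ 0 := by
  unfold harmonicNorm
  have : 0 < (2 * (l : ℝ) + 1) / (4 * Real.pi) * ((l - m).factorial / (l + m).factorial) := by
    positivity
  refine mul_ne_zero (mul_ne_zero (Real.sqrt_pos.2 this).ne' ?_) ?_
  · exact pow_ne_zero _ (by norm_num)
  · positivity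

/-- For fixed `m`, the zonal factors of `Y_l^m` with `l ≥ m` have degrees `0, 1, 2, …`, so they span
all polynomials in `z`. -/
theorem polyMap_zero_right_mem (m : ℕ) (q : Polynomial ℝ) : polyMap m 0 q ∈ harmonicSpan := by
  have hq : q ∈ Submodule.span ℝ (Set.range (rodriguesSequence m)) := by
    rw [(rodriguesSequence m).span fun d =>
      (Polynomial.leadingCoeff_ne_zero.2 ((rodriguesSequence m).ne_zero d)).isUnit]
    trivial
  refine Submodule.span_induction (p := fun q _ => polyMap m 0 q ∈ harmonicSpan) ?_ ?_ ?_ ?_ hq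
  · rintro _ ⟨d, rfl⟩
    have h : polyMap m 0 (rodriguesSequence m d) =
        ((harmonicNorm (m + d) m : ℂ)⁻¹) • harmonicMap (m + d) m := by
      ext p
      have h0 : (harmonicNorm (m + d) m : ℂ) ≠ 0 :=
        Complex.ofReal_ne_zero.2 (harmonicNorm_ne_zero _ _)
      simp only [polyMap, harmonicMap, ContinuousMap.coe_mk, ContinuousMap.smul_apply, smul_eq_mul,
        sphericalHarmonic_natCast, sphericalHarmonicNat_eq, inv_mul_cancel_left₀ h0, pow_zero,
        mul_one]
      rfl
    rw [h]
    exact Submodule.smul_mem _ _ (harmonicMap_mem_harmonicSpan _ _)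
  · rw [show polyMap m 0 0 = 0 from ContinuousMap.ext fun p => by simp [polyMap, zonal]]
    exact Submodule.zero_mem _
  · intro q r _ _ hq hr
    rw [show polyMap m 0 (q + r) = polyMap m 0 q + polyMap m 0 r from
      ContinuousMap.ext fun p => by simp [polyMap, zonal, mul_add]]
    exact Submodule.add_mem _ hq hr
  · intro c q _ hq
    rw [show polyMap m 0 (c • q) = (c : ℂ) • polyMap m 0 q from
      ContinuousMap.ext fun p => by simp [polyMap, zonal]; ring]
    exact Submodule.smul_mem _ _ hq

/-- Paired factors `(x + iy)(x - iy) = 1 - z²` are absorbed into `q`, leaving a power of `x + iy`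
alone; conjugation covers `m < n`. -/
theorem polyMap_mem (m n : ℕ) (q : Polynomial ℝ) : polyMap m n q ∈ harmonicSpan := by
  have key : ∀ m n q, polyMap (m + n) n q ∈ harmonicSpan := by
    intro m n q
    rw [show polyMap (m + n) n q = polyMap m 0 ((1 - Polynomial.X ^ 2) ^ n * q) from
      ContinuousMap.ext fun p => by
        have h : zonal (1 - Polynomial.X ^ 2) p = coordU p * conj (coordU p) := by
          simp [zonal, coordU_mul_conj]
        have h' : zonal ((1 - Polynomial.X ^ 2) ^ n) p = zonal (1 - Polynomial.X ^ 2) p ^ n := by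
          simp [zonal]
        simp only [polyMap, ContinuousMap.coe_mk, zonal_mul, h', h]
        ring]
    exact polyMap_zero_right_mem _ _
  rcases le_total n m with h | h
  · simpa only [Nat.sub_add_cancel h] using key (m - n) n q
  · have := star_mem_harmonicSpan (key (n - m) m q)
    rwa [Nat.sub_add_cancel h, star_polyMap] at this

/-- The polynomial functions `(x + iy)^m (x - iy)^n q(z)` on the sphere. -/
noncomputable def polyMonoid : Submonoid C(S2, ℂ) where
  carrier := {f | ∃ m n q, f = polyMap m n q}
  one_mem' := ⟨0, 0, 1, polyMap_zero.symm⟩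
  mul_mem' := by
    rintro _ _ ⟨m, n, q, rfl⟩ ⟨m', n', r, rfl⟩
    exact ⟨_, _, _, polyMap_mul _ _ _ _ _ _⟩

/-- The star subalgebra of polynomial functions on the sphere. -/
noncomputable def polyStarSubalgebra : StarSubalgebra ℂ C(S2, ℂ) where
  toSubalgebra := Algebra.adjoin ℂ (polyMonoid : Set C(S2, ℂ))
  star_mem' := by
    intro f hf
    refine Algebra.adjoin_induction ?_ ?_ ?_ ?_ hf
    · rintro _ ⟨m, n, q, rfl⟩
      rw [star_polyMap]
      exact Algebra.subset_adjoin ⟨n, m, q, rfl⟩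
    · intro c
      rw [← algebraMap_star_comm]
      exact Subalgebra.algebraMap_mem _ _
    · intro f g _ _ hf hg
      rw [star_add]
      exact Subalgebra.add_mem _ hf hg
    · intro f g _ _ hf hg
      rw [star_mul]
      exact Subalgebra.mul_mem _ hg hf

theorem polyStarSubalgebra_le_harmonicSpan :
    Subalgebra.toSubmodule polyStarSubalgebra.toSubalgebra ≤ harmonicSpan := by
  change Subalgebra.toSubmodule (Algebra.adjoin ℂ (polyMonoid : Set C(S2, ℂ))) ≤ harmonicSpan
  rw [Algebra.adjoin_eq_span, Submonoid.closure_eq, Submodule.span_le]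
  rintro _ ⟨m, n, q, rfl⟩
  exact polyMap_mem m n q

theorem polyStarSubalgebra_separatesPoints : polyStarSubalgebra.SeparatesPoints := by
  intro p p' hne
  have hmem : ∀ m n q, polyMap m n q ∈ polyStarSubalgebra :=
    fun m n q => Algebra.subset_adjoin ⟨m, n, q, rfl⟩
  by_contra hcon
  have h : ∀ f ∈ polyStarSubalgebra, f p = f p' := fun f hf => by
    by_contra hf'
    exact hcon ⟨f, ⟨f, hf, rfl⟩, hf'⟩
  have hU : coordU p = coordU p' := by
    simpa [polyMap, zonal] using h _ (hmem 1 0 1)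
  have hZ : p.1 2 = p'.1 2 := by
    have := h _ (hmem 0 0 Polynomial.X)
    simpa [polyMap, zonal] using this
  apply hne
  apply Subtype.ext
  ext i
  fin_cases i
  · simpa [coordU] using congrArg Complex.re hU
  · simpa [coordU] using congrArg Complex.im hU
  · exact hZ

theorem harmonicSpan_dense : harmonicSpan.topologicalClosure = ⊤ := by
  have h := ContinuousMap.starSubalgebra_topologicalClosure_eq_top_of_separatesPoints
    polyStarSubalgebra polyStarSubalgebra_separatesPoints
  refine top_unique fun f _ => ?_
  have hf : f ∈ closure (polyStarSubalgebra : Set C(S2, ℂ)) := by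
    have : f ∈ polyStarSubalgebra.topologicalClosure := h ▸ StarSubalgebra.mem_top
    exact this
  exact closure_mono polyStarSubalgebra_le_harmonicSpan hf

/-! ### Marginals of rotation invariant measures -/

/-- The constant value of the spherical harmonic of frequency zero. -/
theorem sphericalHarmonic_zero (p : S2) :
    sphericalHarmonic 0 0 p = (Real.sqrt (1 / (4 * Real.pi)) : ℂ) := by
  have := sphericalHarmonic_natCast 0 0 p
  simp only [Nat.cast_zero] at this
  rw [this]
  simp [sphericalHarmonicNat]

/-- Integration against a finite measure as a continuous functional on continuous functions. -/
noncomputable def integralFunctional (ν : Measure S2) [IsFiniteMeasure ν] : C(S2, ℂ) →L[ℂ] ℂ :=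
  LinearMap.mkContinuous
    { toFun := fun f => ∫ p, f p ∂ν
      map_add' := fun f g => integral_add (integrable_of_continuous f.continuous)
        (integrable_of_continuous g.continuous)
      map_smul' := fun c f => integral_const_mul c f } (ν.real Set.univ) fun f => by
    rw [mul_comm]
    exact norm_integral_le_of_norm_le_const (Filter.Eventually.of_forall f.norm_coe_le_norm)

theorem integralFunctional_apply (ν : Measure S2) [IsFiniteMeasure ν] (f : C(S2, ℂ)) :
    integralFunctional ν f = ∫ p, f p ∂ν := rfl

theorem integral_sphericalHarmonic_surfaceMeasure {l : ℕ} (hl : 0 < l) {m : ℤ} (hm : |m| ≤ l) :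
    ∫ p, sphericalHarmonic l m p ∂surfaceMeasure = 0 := by
  rw [← integral_tupleMeasure_one]
  exact (isRotationInvariant_tupleMeasure 1).integral_sphericalHarmonic hl hm 0

/-- A measure whose mass is that of the surface measure and which annihilates the spherical
harmonics of positive frequency is the surface measure. -/
theorem eq_surfaceMeasure_of_integral_sphericalHarmonic {ν : Measure S2} [IsFiniteMeasure ν]
    (hν : ν.real Set.univ = sphereArea)
    (h : ∀ (l : ℕ) (m : ℤ), 0 < l → |m| ≤ l → ∫ p, sphericalHarmonic l m p ∂ν = 0) :
    ν = surfaceMeasure := by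
  have hY : ∀ i : HarmonicIndex, integralFunctional ν (harmonicMap i.1 i.2) =
      integralFunctional surfaceMeasure (harmonicMap i.1 i.2) := by
    intro i
    simp only [integralFunctional_apply, harmonicMap, ContinuousMap.coe_mk]
    rcases i with ⟨l, m, hm⟩
    have hm' := abs_le.2 (Finset.mem_Icc.1 hm)
    rcases l.eq_zero_or_pos with rfl | hl
    · obtain rfl : m = 0 := by simpa using hm
      simp only [sphericalHarmonic_zero, integral_const, hν]
      rfl
    · rw [h l m hl hm', integral_sphericalHarmonic_surfaceMeasure hl hm']
  have hall : integralFunctional ν = integralFunctional surfaceMeasure := by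
    refine ContinuousLinearMap.ext_on (s := Set.range fun i : HarmonicIndex => harmonicMap i.1 i.2)
      ?_ (by rintro _ ⟨i, rfl⟩; exact hY i)
    exact Submodule.dense_iff_topologicalClosure_eq_top.2 harmonicSpan_dense
  refine ext_of_forall_integral_eq_of_IsFiniteMeasure fun f => ?_
  have hf := congrArg (fun T => T ⟨fun p => (f p : ℂ), Complex.continuous_ofReal.comp f.continuous⟩)
    hall
  simp only [integralFunctional_apply, ContinuousMap.coe_mk] at hf
  rw [integral_complex_ofReal, integral_complex_ofReal] at hf
  exact_mod_cast hf

/-- This makes `F (S i)` meaningful and square integrable under `μ` for a class `F` in `L²`. -/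
theorem IsRotationInvariant.measurePreserving_eval {N : ℕ} {μ : Measure (Fin N → S2)}
    [IsFiniteMeasure μ] (hμ : IsRotationInvariant μ) (hmass : μ.real Set.univ = sphereArea)
    (i : Fin N) : MeasurePreserving (fun S : Fin N → S2 => S i) μ surfaceMeasure := by
  have hm : Measurable fun S : Fin N → S2 => S i := measurable_pi_apply i
  refine ⟨hm, eq_surfaceMeasure_of_integral_sphericalHarmonic ?_ fun l m hl hlm => ?_⟩
  · rw [measureReal_def, Measure.map_apply hm MeasurableSet.univ, Set.preimage_univ,
      ← measureReal_def, hmass]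
  · rw [integral_map hm.aemeasurable (integrable_of_continuous
      (continuous_sphericalHarmonic l m)).aestronglyMeasurable]
    exact hμ.integral_sphericalHarmonic hl hlm i

theorem measureReal_univ_patternMeasure {N : ℕ} {P : (Fin N → S2) → ℝ}
    (hP : IsSamplingPattern P) : (patternMeasure P).real Set.univ = sphereArea := by
  have h := integral_patternMeasure hP fun _ => (1 : ℝ)
  rw [integral_const, smul_eq_mul, mul_one] at h
  rw [h, mean, ← hP.integral_eq]
  simp

/-! ### The Hilbert basis of spherical harmonics -/

/-- The spherical harmonics as elements of `L²`. -/
noncomputable def harmonicLp (i : HarmonicIndex) : Lp ℂ 2 surfaceMeasure :=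
  ContinuousMap.toLp 2 surfaceMeasure ℂ (harmonicMap i.1 i.2)

theorem coeFn_harmonicLp (i : HarmonicIndex) :
    harmonicLp i =ᵐ[surfaceMeasure] sphericalHarmonic i.1 i.2 :=
  ContinuousMap.coeFn_toLp surfaceMeasure (harmonicMap i.1 i.2)

theorem inner_harmonicLp (i : HarmonicIndex) {F : S2 → ℂ} {x : Lp ℂ 2 surfaceMeasure}
    (hx : x =ᵐ[surfaceMeasure] F) : inner ℂ (harmonicLp i) x = coeff F i.1 i.2 := by
  rw [L2.inner_def, coeff]
  refine integral_congr_ae ?_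
  filter_upwards [coeFn_harmonicLp i, hx] with p h1 h2
  rw [h1, h2, RCLike.inner_apply]

theorem orthonormal_harmonicLp : Orthonormal ℂ harmonicLp := by
  rw [orthonormal_iff_ite]
  intro i j
  rw [inner_harmonicLp i (coeFn_harmonicLp j), coeff,
    integral_sphericalHarmonic_mul_conj j.abs_le i.abs_le]
  rcases i with ⟨l, m, hm⟩
  rcases j with ⟨l', m', hm'⟩
  refine if_congr ⟨fun h => ?_, fun h => ?_⟩ rfl rfl
  · obtain ⟨rfl, rfl⟩ := Prod.mk.inj h
    rfl
  · cases h
    rfl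

theorem span_harmonicLp_dense :
    (Submodule.span ℂ (Set.range harmonicLp)).topologicalClosure = ⊤ := by
  have h := (ContinuousMap.toLp_denseRange (p := 2) ℂ surfaceMeasure ℂ
    (by norm_num)).topologicalClosure_map_submodule harmonicSpan_dense
  rw [harmonicSpan, Submodule.map_span, ← Set.range_comp] at h
  exact h

/-- The Hilbert basis of spherical harmonics. -/
noncomputable def harmonicBasis : HilbertBasis HarmonicIndex ℂ (Lp ℂ 2 surfaceMeasure) :=
  HilbertBasis.mk orthonormal_harmonicLp span_harmonicLp_dense.ge

theorem harmonicBasis_apply (i : HarmonicIndex) : harmonicBasis i = harmonicLp i :=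
  congrFun (HilbertBasis.coe_mk _ _) i

/-! ### The Monte Carlo estimate as an operator on `L²` -/

section Operator

variable {N : ℕ} {μ : Measure (Fin N → S2)}

/-- The Monte Carlo estimate as an operator from `L²(S²)` to `L²(μ)`. -/
noncomputable def monteCarloOperator
    (h : ∀ i : Fin N, MeasurePreserving (fun S : Fin N → S2 => S i) μ surfaceMeasure) :
    Lp ℂ 2 surfaceMeasure →L[ℂ] Lp ℂ 2 μ :=
  (1 / (N : ℂ)) • ∑ i, (Lp.compMeasurePreservingₗᵢ ℂ _ (h i)).toContinuousLinearMap

theorem coeFn_monteCarloOperator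
    (h : ∀ i : Fin N, MeasurePreserving (fun S : Fin N → S2 => S i) μ surfaceMeasure)
    {F : S2 → ℂ} {x : Lp ℂ 2 surfaceMeasure} (hx : x =ᵐ[surfaceMeasure] F) :
    monteCarloOperator h x =ᵐ[μ] MC F := by
  have h1 : monteCarloOperator h x =
      (1 / (N : ℂ)) • ∑ i, Lp.compMeasurePreserving _ (h i) x := by
    simp [monteCarloOperator]
    rfl
  have h2 : ∀ᵐ S ∂μ, ∀ i : Fin N, Lp.compMeasurePreserving _ (h i) x S = F (S i) := by
    refine ae_all_iff.2 fun i => ?_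
    filter_upwards [Lp.coeFn_compMeasurePreserving x (h i),
      (h i).quasiMeasurePreserving.ae hx] with S e1 e2
    rw [e1, Function.comp_apply, e2]
  rw [h1]
  filter_upwards [Lp.coeFn_smul (1 / (N : ℂ)) (∑ i, Lp.compMeasurePreserving _ (h i) x),
    Lp.coeFn_finsetSum Finset.univ (fun i => Lp.compMeasurePreserving _ (h i) x), h2] with S e1 e2 e3
  rw [e1, Pi.smul_apply, e2, Finset.sum_apply, smul_eq_mul, MC]
  simp only [e3]

/-- The inner product is conjugate-linear in its first argument and `covForm` in its second, hence
the exchange of `F` and `G`. -/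
theorem inner_monteCarloOperator
    (h : ∀ i : Fin N, MeasurePreserving (fun S : Fin N → S2 => S i) μ surfaceMeasure)
    {F G : S2 → ℂ} {x y : Lp ℂ 2 surfaceMeasure} (hx : x =ᵐ[surfaceMeasure] F)
    (hy : y =ᵐ[surfaceMeasure] G) :
    inner ℂ (monteCarloOperator h x) (monteCarloOperator h y) = covForm μ G F := by
  rw [L2.inner_def, covForm]
  refine integral_congr_ae ?_
  filter_upwards [coeFn_monteCarloOperator h hx, coeFn_monteCarloOperator h hy] with S h1 h2
  rw [h1, h2, RCLike.inner_apply]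

theorem covForm_self (f : S2 → ℂ) : covForm μ f f = ((∫ S, ‖MC f S‖ ^ 2 ∂μ : ℝ) : ℂ) := by
  rw [covForm, ← integral_complex_ofReal]
  congr 1
  funext S
  rw [Complex.mul_conj, Complex.normSq_eq_norm_sq]

/-- The second moment of the Monte Carlo estimate in terms of spherical harmonic coefficients. -/
theorem IsRotationInvariant.hasSum_integral_norm_MC_sq [IsFiniteMeasure μ]
    (hμ : IsRotationInvariant μ) (hmass : μ.real Set.univ = sphereArea)
    {F : S2 → ℂ} (hF : MemLp F 2 surfaceMeasure) :
    HasSum (fun i : HarmonicIndex => ‖coeff F i.1 i.2‖ ^ 2 *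
      ∫ S, ‖MC (sphericalHarmonic i.1 i.2) S‖ ^ 2 ∂μ) (∫ S, ‖MC F S‖ ^ 2 ∂μ) := by
  have h := hμ.measurePreserving_eval hmass
  set T := monteCarloOperator h
  set x := hF.toLp
  have hx : x =ᵐ[surfaceMeasure] F := hF.coeFn_toLp
  have hsum : HasSum (fun i => coeff F i.1 i.2 • T (harmonicLp i)) (T x) := by
    have := (harmonicBasis.hasSum_repr x).mapL T
    simp only [HilbertBasis.repr_apply_apply, harmonicBasis_apply, inner_harmonicLp _ hx,
      map_smul] at this
    exact this
  have hT : ∀ i j, inner ℂ (T (harmonicLp i)) (T (harmonicLp j)) =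
      covForm μ (sphericalHarmonic j.1 j.2) (sphericalHarmonic i.1 i.2) := fun i j =>
    inner_monteCarloOperator h (coeFn_harmonicLp i) (coeFn_harmonicLp j)
  -- The images of distinct harmonics are orthogonal in `L²(μ)`, so a single term of the expansion
  -- survives.
  have hTx : ∀ j, inner ℂ (T (harmonicLp j)) (T x) =
      coeff F j.1 j.2 * covForm μ (sphericalHarmonic j.1 j.2) (sphericalHarmonic j.1 j.2) := by
    intro j
    have h1 := hsum.mapL (innerSL ℂ (T (harmonicLp j)))
    simp only [innerSL_apply_apply, inner_smul_right, hT] at h1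
    refine h1.unique (hasSum_single j fun i hij => ?_)
    rw [hμ.covForm_eq_zero i.abs_le j.abs_le fun e => hij ?_, mul_zero]
    rcases i with ⟨l, m, hm⟩
    rcases j with ⟨l', m', hm'⟩
    obtain ⟨rfl, e2⟩ := Prod.mk.inj e
    congr 1
    exact Subtype.ext e2
  have h2 := hsum.mapL (innerSL ℂ (T x))
  simp only [innerSL_apply_apply, inner_smul_right] at h2
  rw [inner_monteCarloOperator h hx hx, covForm_self] at h2
  refine Complex.hasSum_ofReal.1 (h2.congr_fun fun i => ?_)
  rw [← inner_conj_symm, hTx, map_mul, covForm_self, Complex.conj_ofReal]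
  push_cast
  rw [← Complex.mul_conj']
  ring

end Operator

/-! ### The variance formula -/

theorem mean_density {E : Type*} [NormedAddCommGroup E] [NormedSpace ℝ E] {N : ℕ}
    (P : (Fin N → S2) → ℝ) (X : (Fin N → S2) → E) :
    mean (density P) X = (1 / (4 * Real.pi)) • mean P X := by
  simp only [mean, density, sphereArea_eq]
  rw [← integral_smul]
  congr 1
  funext S
  rw [smul_smul]
  congr 1
  ring

theorem sampleCoeff_eq {N : ℕ} (S : Fin N → S2) (l : ℕ) (m : ℤ) :
    sampleCoeff S l m = conj (MC (sphericalHarmonic l m) S) := by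
  simp [sampleCoeff, MC]

theorem norm_sampleCoeff {N : ℕ} (S : Fin N → S2) (l : ℕ) (m : ℤ) :
    ‖sampleCoeff S l m‖ = ‖MC (sphericalHarmonic l m) S‖ := by
  rw [sampleCoeff_eq, RCLike.norm_conj]

theorem MC_sphericalHarmonic_zero {N : ℕ} (hN : 0 < N) (S : Fin N → S2) :
    MC (sphericalHarmonic 0 0) S = (Real.sqrt (1 / (4 * Real.pi)) : ℂ) := by
  have : (N : ℂ) ≠ 0 := by exact_mod_cast hN.ne'
  simp only [MC, sphericalHarmonic_zero, Finset.sum_const, Finset.card_univ, Fintype.card_fin,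
    nsmul_eq_mul]
  field_simp

theorem coeff_zero (F : S2 → ℂ) :
    coeff F 0 0 = (∫ p, F p ∂surfaceMeasure) * (Real.sqrt (1 / (4 * Real.pi)) : ℂ) := by
  simp only [coeff, sphericalHarmonic_zero, Complex.conj_ofReal, integral_mul_const]

theorem memLp_MC {N : ℕ} {μ : Measure (Fin N → S2)}
    (h : ∀ i : Fin N, MeasurePreserving (fun S : Fin N → S2 => S i) μ surfaceMeasure)
    {F : S2 → ℂ} (hF : MemLp F 2 surfaceMeasure) : MemLp (MC F) 2 μ :=
  (memLp_finsetSum _ fun i _ => hF.comp_measurePreserving (h i)).const_mul _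

theorem integral_MC {N : ℕ} (hN : 0 < N) {μ : Measure (Fin N → S2)} [IsFiniteMeasure μ]
    (h : ∀ i : Fin N, MeasurePreserving (fun S : Fin N → S2 => S i) μ surfaceMeasure)
    {F : S2 → ℂ} (hF : MemLp F 2 surfaceMeasure) :
    ∫ S, MC F S ∂μ = ∫ p, F p ∂surfaceMeasure := by
  have h1 : ∀ i : Fin N, ∫ S, F (S i) ∂μ = ∫ p, F p ∂surfaceMeasure := fun i => by
    rw [← (h i).map_eq, integral_map (h i).measurable.aemeasurable]
    rw [(h i).map_eq]
    exact hF.aestronglyMeasurable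
  have h2 : ∀ i : Fin N, Integrable (fun S => F (S i)) μ := fun i =>
    (hF.comp_measurePreserving (h i)).integrable one_le_two
  have : (N : ℂ) ≠ 0 := by exact_mod_cast hN.ne'
  simp only [MC]
  rw [integral_const_mul, integral_finsetSum _ fun i _ => h2 i]
  simp only [h1, Finset.sum_const, Finset.card_univ, Fintype.card_fin, nsmul_eq_mul]
  field_simp

theorem mainTheorem6 (N : ℕ) (hN : 0 < N) (P : (Fin N → S2) → ℝ)
    (hP : IsSamplingPattern P) (hhom : IsHomogeneous P)
    (F : S2 → ℂ) (hF : MemLp F 2 surfaceMeasure) :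
    -- the integrals that define the expected values and the variance converge
    Integrable (fun S => P S • MC F S) (tupleMeasure N) ∧
    Integrable (fun S => P S • ‖MC F S‖ ^ 2) (tupleMeasure N) ∧
    (∀ (l : ℕ) (m : ℤ), Integrable (fun S => P S • ‖sampleCoeff S l m‖ ^ 2) (tupleMeasure N)) ∧
    -- the Monte Carlo estimate is unbiased
    mean P (MC F) = ∫ p, F p ∂surfaceMeasure ∧
    -- the variance formula
    HasSum
      (fun l : ℕ+ =>
        (∑ m ∈ Finset.Icc (-((l : ℕ) : ℤ)) ((l : ℕ) : ℤ), ‖coeff F l m‖ ^ 2) *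
          (∑ m ∈ Finset.Icc (-((l : ℕ) : ℤ)) ((l : ℕ) : ℤ),
            mean (density P) (fun S => ‖sampleCoeff S l m‖ ^ 2)) /
          (2 * ((l : ℕ) : ℝ) + 1))
      (variance (density P) (MC F)) := by
  have := isFiniteMeasure_patternMeasure hP
  have hμ := isRotationInvariant_patternMeasure hhom
  have hmass := measureReal_univ_patternMeasure hP
  have hev := hμ.measurePreserving_eval hmass
  have hmem := memLp_MC hev hF
  have hmean : mean P (MC F) = ∫ p, F p ∂surfaceMeasure := by
    rw [← integral_patternMeasure hP, integral_MC hN hev hF]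
  refine ⟨(integrable_patternMeasure_iff hP _).1 (hmem.integrable one_le_two),
    (integrable_patternMeasure_iff hP _).1 (MemLp.integrable_norm_pow (p := 2) hmem two_ne_zero),
    fun l m => (integrable_patternMeasure_iff hP _).1 ?_, hmean, ?_⟩
  · simp only [norm_sampleCoeff]
    exact MemLp.integrable_norm_pow (p := 2) (memLp_MC hev
      (MemLp.of_bound (integrable_of_continuous
        (continuous_sphericalHarmonic l m)).aestronglyMeasurable _
        (Filter.Eventually.of_forall (harmonicMap l m).norm_coe_le_norm))) two_ne_zero
  -- The value of the form common to all `2l + 1` harmonics of frequency `l`. Summing it over `m`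
  -- and dividing by `2l + 1` returns it.
  set c : ℕ → ℝ := fun l => ∫ S, ‖MC (sphericalHarmonic l l) S‖ ^ 2 ∂patternMeasure P with hc
  have hcm : ∀ (l : ℕ) (m : ℤ), |m| ≤ l →
      ∫ S, ‖MC (sphericalHarmonic l m) S‖ ^ 2 ∂patternMeasure P = c l := by
    intro l m hm
    have := hμ.covForm_self_eq hm
    rw [covForm_self, covForm_self] at this
    exact_mod_cast this
  have hsc : ∀ (l : ℕ) (m : ℤ), |m| ≤ l →
      mean (density P) (fun S => ‖sampleCoeff S l m‖ ^ 2) = 1 / (4 * Real.pi) * c l := by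
    intro l m hm
    simp only [mean_density, norm_sampleCoeff, ← integral_patternMeasure hP, hcm l m hm,
      smul_eq_mul]
  have hsum := (hμ.hasSum_integral_norm_MC_sq hmass hF).mul_left (1 / (4 * Real.pi))
  have hsum' := hsum.sigma (g := fun l : ℕ =>
    (∑ m ∈ Finset.Icc (-(l : ℤ)) (l : ℤ), ‖coeff F l m‖ ^ 2) *
      (∑ m ∈ Finset.Icc (-(l : ℤ)) (l : ℤ),
        mean (density P) (fun S => ‖sampleCoeff S l m‖ ^ 2)) / (2 * (l : ℝ) + 1)) (fun l => by
    have h1 : ∑ m ∈ Finset.Icc (-(l : ℤ)) (l : ℤ),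
        mean (density P) (fun S => ‖sampleCoeff S l m‖ ^ 2) =
        (2 * (l : ℝ) + 1) * (1 / (4 * Real.pi) * c l) := by
      rw [Finset.sum_congr rfl fun m hm => hsc l m (abs_le.2 (Finset.mem_Icc.1 hm)),
        Finset.sum_const, Int.card_Icc, nsmul_eq_mul]
      congr 1
      rw [show ((l : ℤ) + 1 - -(l : ℤ)).toNat = 2 * l + 1 by omega]
      push_cast
      ring
    have h2 : (∑ m ∈ Finset.Icc (-(l : ℤ)) (l : ℤ), ‖coeff F l m‖ ^ 2) *
        ((2 * (l : ℝ) + 1) * (1 / (4 * Real.pi) * c l)) / (2 * (l : ℝ) + 1) =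
        ∑ m : Finset.Icc (-(l : ℤ)) (l : ℤ), 1 / (4 * Real.pi) * (‖coeff F l m‖ ^ 2 *
          ∫ S, ‖MC (sphericalHarmonic l m) S‖ ^ 2 ∂patternMeasure P) := by
      rw [Finset.sum_coe_sort (Finset.Icc (-(l : ℤ)) (l : ℤ)) (fun m => 1 / (4 * Real.pi) *
        (‖coeff F l m‖ ^ 2 * ∫ S, ‖MC (sphericalHarmonic l m) S‖ ^ 2 ∂patternMeasure P)),
        ← Finset.mul_sum]
      have h3 : ∑ m ∈ Finset.Icc (-(l : ℤ)) (l : ℤ), ‖coeff F l m‖ ^ 2 *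
          ∫ S, ‖MC (sphericalHarmonic l m) S‖ ^ 2 ∂patternMeasure P =
          (∑ m ∈ Finset.Icc (-(l : ℤ)) (l : ℤ), ‖coeff F l m‖ ^ 2) * c l := by
        rw [Finset.sum_mul]
        refine Finset.sum_congr rfl fun m hm => ?_
        rw [hcm l m (abs_le.2 (Finset.mem_Icc.1 hm))]
      rw [h3]
      have : (2 * (l : ℝ) + 1) ≠ 0 := by positivity
      field_simp
    rw [h1, h2]
    exact hasSum_fintype _)
  -- Extending the sum to `l = 0` adds that term to the total; it remains to see that it equals the
  -- squared modulus of the mean.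
  refine (hasSum_pnat_iff (f := fun l : ℕ =>
    (∑ m ∈ Finset.Icc (-(l : ℤ)) (l : ℤ), ‖coeff F l m‖ ^ 2) *
      (∑ m ∈ Finset.Icc (-(l : ℤ)) (l : ℤ),
        mean (density P) (fun S => ‖sampleCoeff S l m‖ ^ 2)) / (2 * (l : ℝ) + 1))).2 ?_
  convert! hsum' using 1
  -- The constant `|Y_0^0|² = 1/(4π)` is integrated against total mass `4π`.
  have hc0 : c 0 = 1 := by
    have hs : Real.sqrt (1 / (4 * Real.pi)) ^ 2 = 1 / (4 * Real.pi) := Real.sq_sqrt (by positivity)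
    simp only [hc, Nat.cast_zero, MC_sphericalHarmonic_zero hN, Complex.norm_real,
      Real.norm_eq_abs, sq_abs, hs, integral_const, hmass, sphereArea_eq, smul_eq_mul]
    have := Real.pi_ne_zero
    field_simp
  have hF0 : ‖coeff F 0 0‖ ^ 2 = ‖∫ p, F p ∂surfaceMeasure‖ ^ 2 * (1 / (4 * Real.pi)) := by
    rw [coeff_zero, norm_mul, mul_pow, Complex.norm_real, Real.norm_eq_abs, sq_abs,
      Real.sq_sqrt (by positivity)]
  have hs0 := hsc 0 0 (by simp)
  simp only [Nat.cast_zero, neg_zero, Finset.Icc_self, Finset.sum_singleton, variance,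
    hs0, hF0, hc0]
  rw [mean_density, mean_density, hmean, ← integral_patternMeasure hP, norm_smul, mul_pow,
    Real.norm_eq_abs, sq_abs, smul_eq_mul]
  ring
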